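/- All coefficients are in $\mathbb F_2=\mathbb Z/2$, and $n\ge 0$ is fixed. **Pseudomanifolds.** An $n$-dimensional topological pseudomanifold is a topological space $X$ with a filtration by closed subsets $\emptyset=X_{-1}\subseteq X_0\subseteq\cdots\subseteq X_{n-2}=X_{n-1}\subseteq X_n=X$ such that each $X_i\setminus X_{i-1}$ is a (possibly empty) metrizable topological manifold of dimension $i$, $X_n\setminus X_{n-2}$ is dense in $X$, and each $x\in X_i\setminus X_{i-1}$ has an open neighbourhood $V$ in $X$, an open neighbourhood $U$ in $X_i\setminus X_{i-1}$, a compact topological pseudomanifold $L$ of dimension $n-i-1$ (empty if $i=n$) and a homeomorphism $\varphi\colon U\times\mathring cL\to V$ with $\varphi(u,\vartheta)=u$ and $\varphi(U\times\mathring cL_j)=V\cap X_{i+j+1}$ for all $j\ge -1$. Here $\mathring cL=L\times[0,1[\,/\,L\times\{0\}$ is the open cone with summit $\vartheta$, and $\mathring c\emptyset=\{\vartheta\}$. A continuous map $f\colon X\to Y$ of $n$-dimensional pseudomanifolds is stratum preserving if $f^{-1}(Y_{n-\ell})=X_{n-\ell}$ for all $\ell\ge 0$. **Filtered simplices.** For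 each $(j_0,\dots,j_n)$ with $j_i\ge -1$ (and $\Delta^{-1}=\emptyset$), let $\underline{\mathrm{ISing}}^{\mathcal F}(X)_{j_0,\dots,j_n}$ be the set of continuous maps $\sigma\colon\Delta^{j_0}*\cdots*\Delta^{j_n}\to X$ with $\sigma^{-1}(X_i)=\Delta^{j_0}*\cdots*\Delta^{j_i}$ for all $i$. It is contravariant in the joins of injective order-preserving maps $\Delta^{j_i}\to\Delta^{k_i}$. A simplex is called regular if $j_n\ge 0$. **Cochains.** For a regular simplex $\sigma$ put $\widetilde N^*_\sigma=N^*(c\Delta^{j_0})\otimes\cdots\otimes N^*(c\Delta^{j_{n-1}})\otimes N^*(\Delta^{j_n})$, where $N^*$ denotes normalized cochains and $c\Delta^{j}$ is the simplex with one more vertex, the apex, placed last. A global section $c$ of degree $k$ is a family of elements $c_\sigma\in\widetilde N^k_\sigma$, for all regular $\sigma$, compatible with all the maps between regular simplices, and $(\delta c)_\sigma=\delta(c_\sigma)$. For $1\le\ell\le n$, let $c_{\sigma,n-\ell}$ be the restriction of $c_\sigma$ obtained by restricting the factor $N^*(c\Delta^{j_{n-\ell}})$ to $N^*(\Delta^{j_{n-\ell}}\times\{1\})$,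 the base of the cone. Then $\|c_\sigma\|_\ell$ is the largest total degree in the factors of index $>n-\ell$ of the elements of the canonical tensor basis that occur in $c_{\sigma,n-\ell}$; it is $-\infty$ if $c_{\sigma,n-\ell}=0$ or $\Delta^{j_{n-\ell}}=\emptyset$. Put $\|c\|_\ell=\sup_\sigma\|c_\sigma\|_\ell$. A loose perversity is a map $\overline p\colon\mathbb N\to\mathbb Z$ with $\overline p(0)=0$. Loose perversities are ordered and added pointwise. The complex $\widetilde N^*_{\overline p}=\widetilde N^*_{\overline p}(\underline{\mathrm{ISing}}^{\mathcal F}(X))$ consists of the global sections $c$ with $\|c\|_\ell\le\overline p(\ell)$ and $\|\delta c\|_\ell\le\overline p(\ell)$ for $1\le\ell\le n$. With the inclusions for $\overline p\le\overline q$, $\overline p\mapsto\widetilde N^*_{\overline p}$ is a functor to cochain complexes (a generalized perverse cochain complex). **Algebras.** Let $\mathcal E(2)$ be the complex with $\mathcal E(2)_i=\mathbb F_2(e_i,\tau_i)$ in degree $-i$ for $i\ge 0$, $de_i=d\tau_i=e_{i-1}+\tau_{i-1}$ (zero if $i=0$), with $\Sigma_2$ exchanging $e_i$ and $\tau_i$.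 A perverse $\mathcal E(2)$-algebra structure on a generalized perverse cochain complex $A$ is a family of cochain maps $\psi\colon\mathcal E(2)\otimes A_{\overline p}\otimes A_{\overline q}\to A_{\overline p+\overline q}$, natural in $\overline p,\overline q$ and $\Sigma_2$-equivariant, i.e. $\psi(\tau g\otimes x\otimes y)=\psi(g\otimes y\otimes x)$, where $\tau$ is the generator of $\Sigma_2$. Write $x\cup_iy=\psi(e_i\otimes x\otimes y)$. The structure is nice if $x\cup_{|x|}x=x$ (compared in $A_{\overline q}$ for every $\overline q\ge\overline p,2\overline p$, where $x\in A_{\overline p}$) and $x\cup_iy=0$ for $i>\min(|x|,|y|)$. **Cup-$i$ products on simplices.** On the normalized cochains of an ordered simplex, let $\cup_i$ be Steenrod's product: the value of $x\cup_iy$ on a simplex with vertices $0<\cdots<d$ is $\sum_{u_0<\cdots<u_i}x([0,u_0]\cup[u_1,u_2]\cup\cdots)\,y([u_0,u_1]\cup[u_2,u_3]\cup\cdots)$, where a cochain is zero on simplices of a dimension other than its degree. On $\widetilde N^*_\sigma$, let $\cup_i$ be the bilinear product with $$(x_0\otimes\cdots\otimes x_n)\cup_i(y_0\otimes\cdots\otimes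 y_n)=\sum_{i_0+\cdots+i_n=i}\ \bigotimes_{k=0}^n\tau^{i_0+\cdots+i_{k-1}}(x_k\cup_{i_k}y_k),\qquad \tau(x\cup_jy)=y\cup_jx .$$ **Theorem.** Let $n\ge 0$. For every $n$-dimensional topological pseudomanifold $X$, the formula $(c\cup_ic')_\sigma=c_\sigma\cup_ic'_\sigma$ defines a nice perverse $\mathcal E(2)$-algebra structure on $\overline p\mapsto\widetilde N^*_{\overline p}(\underline{\mathrm{ISing}}^{\mathcal F}(X))$. These structures are natural: for every stratum preserving map $f\colon X\to Y$, the induced map $f^*\colon\widetilde N^*_{\bullet}(\underline{\mathrm{ISing}}^{\mathcal F}(Y))\to\widetilde N^*_{\bullet}(\underline{\mathrm{ISing}}^{\mathcal F}(X))$ satisfies $f^*\psi(g\otimes x\otimes y)=\psi(g\otimes f^*x\otimes f^*y)$. -/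

import Mathlib

open CategoryTheory Opposite

universe u

noncomputable section

namespace PerverseCochain

/-! ## Filtered simplices and filtered face sets

The integer `n` is the formal dimension. -/

/-- The join `Δ^{j₀} ∗ ⋯ ∗ Δ^{jₙ}`, recorded by the number of vertices `size i = jᵢ + 1` of each
factor (`size i = 0` when `Δ^{jᵢ}` is empty). -/
structure FilteredSimplex (n : ℕ) where
  size : Fin (n + 1) → ℕ

/-- A morphism is a join `∗ᵢ ∂ᵢ` of injective order-preserving maps. -/
instance FilteredSimplex.category (n : ℕ) : Category (FilteredSimplex n) where
  Hom Δ Δ' := ∀ i, Fin (Δ.size i) ↪o Fin (Δ'.size i)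
  id Δ := fun i => RelEmbedding.refl _
  comp f g := fun i => (f i).trans (g i)

/-- The objects with `jₙ ≥ 0`. -/
def FilteredSimplex.regular (n : ℕ) : ObjectProperty (FilteredSimplex n) :=
  fun Δ => 0 < Δ.size (Fin.last n)

/-- The full subcategory of the filtered simplices with `Δ^{jₙ} ≠ ∅`. -/
abbrev RegularSimplex (n : ℕ) := (FilteredSimplex.regular n).FullSubcategory

/-- Filtered face sets, with natural transformations as morphisms. -/
abbrev FilteredFaceSet (n : ℕ) := (FilteredSimplex n)ᵒᵖ ⥤ Type u

/-- The restriction `K₊` of a filtered face set to the regular simplices. -/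
abbrev FilteredFaceSet.plus {n : ℕ} (K : FilteredFaceSet.{u} n) : (RegularSimplex n)ᵒᵖ ⥤ Type u :=
  (FilteredSimplex.regular n).ι.op ⋙ K

/-! ## Cochains on the blow-up of a simplex

The simplicial set `cΔ^j` is the simplex with totally ordered vertex set `WithTop (Fin (j + 1))`,
the apex of the cone being `⊤`.  The nondegenerate simplices of a simplex with totally ordered
vertex set `V` are the nonempty finite subsets of `V`; they index the canonical basis of the
normalized cochains.  Hence `N^*(cΔ^{j₀}) ⊗ ⋯ ⊗ N^*(cΔ^{jₙ₋₁}) ⊗ N^*(Δ^{jₙ})` is the space of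
`𝔽₂`-valued functions on the set of tuples `(s₀, …, sₙ)`, where `sᵢ` is a nondegenerate simplex of
`cΔ^{jᵢ}` for `i < n`, and of `Δ^{jₙ}` for `i = n`. -/

/-- A basis element `(s₀, …, sₙ)` of the tensor product attached to `Δ`. -/
@[ext]
structure Cell {n : ℕ} (Δ : FilteredSimplex n) where
  simplex : ∀ i, Finset (WithTop (Fin (Δ.size i)))
  nonempty : ∀ i, (simplex i).Nonempty
  top_notMem : ⊤ ∉ simplex (Fin.last n)

namespace Cell

variable {n : ℕ} {Δ Δ' Δ'' : FilteredSimplex n}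

lemma simplex_injective : Function.Injective (simplex : Cell Δ → _) :=
  fun _ _ h => Cell.ext h

instance : Fintype (Cell Δ) := Fintype.ofInjective simplex simplex_injective

/-- The dimension of the `i`-th simplex of the tuple. -/
def dimAt (s : Cell Δ) (i : Fin (n + 1)) : ℤ := ((s.simplex i).card : ℤ) - 1

/-- The total dimension. -/
def dim (s : Cell Δ) : ℤ := ∑ i, s.dimAt i

/-- `t` is a codimension one face of `s`: one vertex of one of the simplices is removed. -/
def IsFacet (t s : Cell Δ) : Prop := (∀ i, t.simplex i ⊆ s.simplex i) ∧ s.dim = t.dim + 1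

/-- The image of a tuple under a map of filtered simplices, extended to the cones by sending apex
to apex. -/
def map (f : Δ ⟶ Δ') (s : Cell Δ) : Cell Δ' :=
  ⟨fun i => (s.simplex i).map (OrderEmbedding.withTopMap (f i)).toEmbedding,
    fun i => (s.nonempty i).map, by
      intro h
      obtain ⟨v, hv, hv'⟩ := Finset.mem_map.1 h
      cases v with
      | top => exact s.top_notMem hv
      | coe v => exact WithTop.coe_ne_top hv'⟩

@[simp] lemma dim_map (f : Δ ⟶ Δ') (s : Cell Δ) : (s.map f).dim = s.dim := by
  simp [dim, dimAt, map]

lemma map_injective (f : Δ ⟶ Δ') : Function.Injective (map f) := by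
  intro s t h
  apply Cell.ext
  funext i
  exact Finset.map_injective _ (congrFun (congrArg Cell.simplex h) i)

lemma isFacet_map (f : Δ ⟶ Δ') {s t : Cell Δ} : (t.map f).IsFacet (s.map f) ↔ t.IsFacet s := by
  unfold IsFacet
  rw [dim_map, dim_map]
  simp [map]

lemma exists_of_isFacet_map (f : Δ ⟶ Δ') {s : Cell Δ} {t : Cell Δ'} (h : t.IsFacet (s.map f)) :
    ∃ t' : Cell Δ, t'.map f = t := by
  have key : ∀ i, ∃ w : Finset (WithTop (Fin (Δ.size i))), w ⊆ s.simplex i ∧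
      t.simplex i = w.map (OrderEmbedding.withTopMap (f i)).toEmbedding := fun i =>
    Finset.subset_map_iff.1 (h.1 i)
  choose w hw hw' using key
  refine ⟨⟨w, fun i => ?_, fun h' => s.top_notMem (hw _ h')⟩, Cell.ext (funext fun i => (hw' i).symm)⟩
  have := t.nonempty i
  rw [hw' i] at this
  exact Finset.map_nonempty.1 this

end Cell

/-- The `𝔽₂`-vector space `N^*(cΔ^{j₀}) ⊗ ⋯ ⊗ N^*(cΔ^{jₙ₋₁}) ⊗ N^*(Δ^{jₙ})` (sum of all degrees). -/
abbrev LocalCochain {n : ℕ} (Δ : FilteredSimplex n) : Type := Cell Δ → ZMod 2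

namespace LocalCochain

variable {n : ℕ} {Δ Δ' : FilteredSimplex n}

open Classical in
/-- The differential of the tensor product of cochain complexes: the value on a tuple is the sum of
the values on its codimension one faces (over `𝔽₂` there are no signs). -/
def coboundary : LocalCochain Δ →ₗ[ZMod 2] LocalCochain Δ where
  toFun c s := ∑ t with t.IsFacet s, c t
  map_add' c c' := by ext s; simp [Finset.sum_add_distrib]
  map_smul' a c := by ext s; simp [Finset.mul_sum]

lemma coboundary_comp_map (f : Δ ⟶ Δ') (c : LocalCochain Δ') :
    coboundary (c ∘ Cell.map f) = coboundary c ∘ Cell.map f := by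
  classical
  ext s
  simp only [coboundary, LinearMap.coe_mk, AddHom.coe_mk, Function.comp_apply]
  refine Finset.sum_bij (fun t _ => Cell.map f t) ?_ ?_ ?_ ?_
  · intro t ht
    simpa [Cell.isFacet_map] using ht
  · intro t _ t' _ h
    exact Cell.map_injective f h
  · intro t ht
    rw [Finset.mem_filter] at ht
    obtain ⟨t', rfl⟩ := Cell.exists_of_isFacet_map f ht.2
    exact ⟨t', by simpa [Cell.isFacet_map] using ht.2, rfl⟩
  · intro t _
    rfl

lemma coboundary_coboundary (c : LocalCochain Δ) : coboundary (coboundary c) = 0 := by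
  classical
  ext u
  simp only [coboundary, LinearMap.coe_mk, AddHom.coe_mk, Pi.zero_apply]
  have h1 : ∀ s : Cell Δ, (∑ t with t.IsFacet s, c t) =
      ∑ t, if t.IsFacet s then c t else 0 := fun s => Finset.sum_filter _ _
  simp only [h1]
  rw [Finset.sum_comm]
  refine Finset.sum_eq_zero fun t _ => ?_
  rw [← Finset.sum_filter, Finset.filter_filter]
  by_cases htu : u.dim = t.dim + 1 + 1
  swap
  · rw [Finset.sum_eq_zero]
    intro s hs
    rw [Finset.mem_filter] at hs
    exact absurd (by rw [hs.2.1.2, hs.2.2.2]) htu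
  refine Finset.sum_involution (fun s hs =>
    ⟨fun i => t.simplex i ∪ (u.simplex i \ s.simplex i), fun i => (t.nonempty i).mono Finset.subset_union_left, ?_⟩)
    ?_ ?_ ?_ ?_
  · rw [Finset.mem_union, not_or]
    exact ⟨t.top_notMem, fun h => u.top_notMem (Finset.mem_sdiff.1 h).1⟩
  · intro s hs
    exact CharTwo.add_self_eq_zero _
  · intro s hs _ h
    rw [Finset.mem_filter] at hs
    have hsu : s = u := by
      apply Cell.ext
      funext i
      refine Finset.Subset.antisymm (hs.2.1.1 i) fun v hv => ?_
      by_contra hvs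
      have h2 : t.simplex i ∪ (u.simplex i \ s.simplex i) = s.simplex i := congrFun (congrArg Cell.simplex h) i
      apply hvs
      rw [← h2]
      exact Finset.mem_union_right _ (Finset.mem_sdiff.2 ⟨hv, hvs⟩)
    have := hs.2.1.2
    rw [hsu] at this
    omega
  · intro s hs
    rw [Finset.mem_filter] at hs ⊢
    obtain ⟨-, ⟨hsu, hsu'⟩, ⟨hts, hts'⟩⟩ := hs
    have hcard : ∀ i, ((t.simplex i ∪ (u.simplex i \ s.simplex i)).card : ℤ) =
        (t.simplex i).card + (u.simplex i).card - (s.simplex i).card := by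
      intro i
      rw [Finset.card_union_of_disjoint, Nat.cast_add, Finset.card_sdiff_of_subset (hsu i),
        Nat.cast_sub (Finset.card_le_card (hsu i))]
      · ring
      · exact Finset.disjoint_left.2 fun v hv hv' => (Finset.mem_sdiff.1 hv').2 (hts i hv)
    have hdim : (∑ i, (((t.simplex i ∪ (u.simplex i \ s.simplex i)).card : ℤ) - 1)) =
        t.dim + u.dim - s.dim := by
      simp only [Cell.dim, Cell.dimAt]
      rw [← Finset.sum_add_distrib, ← Finset.sum_sub_distrib]
      refine Finset.sum_congr rfl fun i _ => ?_
      rw [hcard i]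
      ring
    refine ⟨Finset.mem_univ _, ⟨fun i => ?_, ?_⟩, ⟨fun i => ?_, ?_⟩⟩
    · exact Finset.union_subset ((hts i).trans (hsu i)) Finset.sdiff_subset
    · simp only [Cell.dim, Cell.dimAt] at hdim hsu' hts' htu ⊢
      omega
    · exact Finset.subset_union_left
    · simp only [Cell.dim, Cell.dimAt] at hdim hsu' hts' htu ⊢
      omega
  · intro s hs
    rw [Finset.mem_filter] at hs
    apply Cell.ext
    funext i
    have h1 := hs.2.1.1 i
    have h2 := hs.2.2.1 i
    ext v
    have h1' := @h1 v
    have h2' := @h2 v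
    simp only [Finset.mem_union, Finset.mem_sdiff]
    tauto

/-- The `ℓ`-perverse degree, for `1 ≤ ℓ ≤ n`.  The tuples `s` with `⊤ ∉ s_{n-ℓ}` are those of the
basis of the tensor product in which the factor `cΔ^{j_{n-ℓ}}` is replaced with
`Δ^{j_{n-ℓ}} × {1}`; the supremum is over those in the support of the restriction of `c`, of the
degree of the part `s_{n-ℓ+1} ⊗ ⋯ ⊗ s_n`. It is `-∞` if this restriction is zero, and in particular
if `Δ^{j_{n-ℓ}}` is empty. -/
def perverseDegree (ℓ : ℕ) (c : LocalCochain Δ) : WithBot (WithTop ℤ) :=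
  ⨆ (s : Cell Δ) (_ : c s ≠ 0 ∧ ∀ i : Fin (n + 1), (i : ℕ) + ℓ = n → ⊤ ∉ s.simplex i),
    (((∑ i with n < (i : Fin (n + 1)).val + ℓ, s.dimAt i : ℤ) : WithTop ℤ) : WithBot (WithTop ℤ))

end LocalCochain

/-! ## Cup-`i` products on the blow-up of a simplex -/

/-- The coefficient of `a ⊗ b` in the `i`-th Steenrod diagonal of a simplex `s` with totally ordered
vertices `0, …, d`: it is `1` if there are vertices `u₀ < u₁ < ⋯ < uᵢ` of `s` such that
`a = [0, u₀] ∪ [u₁, u₂] ∪ ⋯` and `b = [u₀, u₁] ∪ [u₂, u₃] ∪ ⋯`, and `0` otherwise. Equivalently,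
`s = a ∪ b`, `a ∩ b = {u₀, …, uᵢ}`, and a vertex `v` outside `a ∩ b` lies in `a`, respectively in
`b`, if the number of `uₖ < v` is even, respectively odd. -/
def steenrodCoeff {V : Type} [LinearOrder V] (i : ℕ) (a b s : Finset V) : ZMod 2 :=
  open Classical in
  if a ∪ b = s ∧ (a ∩ b).card = i + 1 ∧
      (∀ v ∈ a \ b, Even ((a ∩ b).filter (· < v)).card) ∧
      (∀ v ∈ b \ a, Odd ((a ∩ b).filter (· < v)).card) then 1 else 0

/-- The coefficient of `a ⊗ b` in the diagonal of the tuple `s`, given by the iterated diagonal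
`e_i ↦ ∑ e_{i₀} ⊗ τ^{i₀} e_{i₁} ⊗ ⋯ ⊗ τ^{i₀ + ⋯ + iₙ₋₁} e_{iₙ}` of `𝓔(2)`, where `τ` exchanges the two
arguments. -/
def cupCoeff {n : ℕ} {Δ : FilteredSimplex n} (i : ℕ) (a b s : Cell Δ) : ZMod 2 :=
  ∑ I ∈ Finset.piAntidiag (Finset.univ : Finset (Fin (n + 1))) i,
    ∏ k, if Even (∑ l with l < k, I l) then steenrodCoeff (I k) (a.simplex k) (b.simplex k) (s.simplex k)
      else steenrodCoeff (I k) (b.simplex k) (a.simplex k) (s.simplex k)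

/-- The product `c ∪_i c'` on the cochains of the blow-up of a simplex. -/
def LocalCochain.cup {n : ℕ} {Δ : FilteredSimplex n} (i : ℕ) (c c' : LocalCochain Δ) :
    LocalCochain Δ :=
  fun s => ∑ a, ∑ b, cupCoeff i a b s * (c a * c' b)

/-! ## Global sections -/

/-- The global sections on `K` (sum of all degrees): families `c_σ`, indexed by the simplices `σ` of
`K₊`, compatible with all the maps of regular simplices. -/
def Sections {n : ℕ} (K : FilteredFaceSet.{u} n) :
    Submodule (ZMod 2) (∀ Δ : RegularSimplex n, K.plus.obj (op Δ) → LocalCochain Δ.obj) where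
  carrier := {c | ∀ (Δ Δ' : RegularSimplex n) (f : Δ' ⟶ Δ) (σ : K.plus.obj (op Δ)),
    c Δ' (K.plus.map f.op σ) = c Δ σ ∘ Cell.map f.hom}
  zero_mem' _ _ _ _ := rfl
  add_mem' {c c'} hc hc' Δ Δ' f σ := by
    have h1 := hc Δ Δ' f σ
    have h2 := hc' Δ Δ' f σ
    simp only [Pi.add_apply, h1, h2]
    rfl
  smul_mem' a c hc Δ Δ' f σ := by
    have h1 := hc Δ Δ' f σ
    simp only [Pi.smul_apply, h1]
    rfl

namespace Sections

variable {n : ℕ} {K K' : FilteredFaceSet.{u} n}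

/-- The differential `(δ c)_σ = δ (c_σ)`. -/
def coboundary : Sections K →ₗ[ZMod 2] Sections K where
  toFun c := ⟨fun Δ σ => LocalCochain.coboundary (c.1 Δ σ), fun Δ Δ' f σ =>
    (congrArg LocalCochain.coboundary (c.2 Δ Δ' f σ)).trans
      (LocalCochain.coboundary_comp_map f.hom (c.1 Δ σ))⟩
  map_add' c c' := by
    apply Subtype.ext
    funext Δ σ
    exact map_add _ _ _
  map_smul' a c := by
    apply Subtype.ext
    funext Δ σ
    exact LocalCochain.coboundary.map_smul a (c.1 Δ σ)

lemma coboundary_coboundary (c : Sections K) : coboundary (coboundary c) = 0 := by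
  apply Subtype.ext
  funext Δ σ
  exact LocalCochain.coboundary_coboundary _

/-- The global sections of degree `k`. -/
def degree (K : FilteredFaceSet.{u} n) (k : ℤ) : Submodule (ZMod 2) (Sections K) where
  carrier := {c | ∀ Δ σ (s : Cell Δ.obj), c.1 Δ σ s ≠ 0 → s.dim = k}
  zero_mem' Δ σ s h := absurd rfl h
  add_mem' {c c'} hc hc' Δ σ s h := by
    by_cases h0 : c.1 Δ σ s = 0
    · refine hc' Δ σ s fun h0' => h ?_
      change c.1 Δ σ s + c'.1 Δ σ s = 0
      rw [h0, h0', add_zero]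
    · exact hc Δ σ s h0
  smul_mem' a c hc Δ σ s h := by
    refine hc Δ σ s fun h0 => h ?_
    change a * c.1 Δ σ s = 0
    rw [h0, mul_zero]

lemma coboundary_mem_degree {k : ℤ} {c : Sections K} (hc : c ∈ degree K k) :
    coboundary c ∈ degree K (k + 1) := by
  classical
  intro Δ σ s hs
  have hs' : ∑ t with t.IsFacet s, c.1 Δ σ t ≠ 0 := hs
  obtain ⟨t, ht, ht'⟩ := Finset.exists_ne_zero_of_sum_ne_zero hs'
  rw [Finset.mem_filter] at ht
  rw [ht.2.2, hc Δ σ t ht']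

/-- The `ℓ`-th component of the perverse degree of a global section. -/
def perverseDegree (ℓ : ℕ) (c : Sections K) : WithBot (WithTop ℤ) :=
  ⨆ (Δ : RegularSimplex n) (σ : K.plus.obj (op Δ)), (c.1 Δ σ).perverseDegree ℓ

end Sections

/-! ## Perversities and sections of `p`-intersection -/

/-- Loose perversities. -/
@[ext]
structure LoosePerversity where
  toFun : ℕ → ℤ
  map_zero : toFun 0 = 0

namespace LoosePerversity

instance : PartialOrder LoosePerversity := PartialOrder.lift toFun fun _ _ => LoosePerversity.ext

instance : Add LoosePerversity :=
  ⟨fun p q => ⟨p.toFun + q.toFun, by simp [p.map_zero, q.map_zero]⟩⟩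

lemma add_comm (p q : LoosePerversity) : p + q = q + p :=
  LoosePerversity.ext (_root_.add_comm p.toFun q.toFun)

lemma add_le_add {p p' q q' : LoosePerversity} (hp : p ≤ p') (hq : q ≤ q') : p + q ≤ p' + q' :=
  fun i => _root_.add_le_add (hp i) (hq i)

end LoosePerversity

namespace Sections

variable {n : ℕ} {K K' K'' : FilteredFaceSet.{u} n}

/-- A global section is `p`-admissible if `‖c‖_ℓ ≤ p(ℓ)` for all `ℓ ∈ {1, …, n}`. -/
def Admissible (p : LoosePerversity) (c : Sections K) : Prop :=
  ∀ ℓ : ℕ, 1 ≤ ℓ → ℓ ≤ n → perverseDegree ℓ c ≤ ((p.toFun ℓ : WithTop ℤ) : WithBot (WithTop ℤ))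

lemma admissible_iff {p : LoosePerversity} {c : Sections K} :
    Admissible p c ↔ ∀ ℓ : ℕ, 1 ≤ ℓ → ℓ ≤ n → ∀ Δ σ (s : Cell Δ.obj), c.1 Δ σ s ≠ 0 →
      (∀ i : Fin (n + 1), (i : ℕ) + ℓ = n → ⊤ ∉ s.simplex i) →
      (∑ i with n < (i : Fin (n + 1)).val + ℓ, s.dimAt i) ≤ p.toFun ℓ := by
  simp only [Admissible, perverseDegree, LocalCochain.perverseDegree, iSup_le_iff,
    WithBot.coe_le_coe, WithTop.coe_le_coe, and_imp]

lemma admissible_zero (p : LoosePerversity) : Admissible p (0 : Sections K) :=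
  admissible_iff.2 fun _ _ _ _ _ _ h => absurd rfl h

lemma Admissible.add {p : LoosePerversity} {c c' : Sections K} (hc : Admissible p c)
    (hc' : Admissible p c') : Admissible p (c + c') := by
  rw [admissible_iff] at *
  intro ℓ h1 h2 Δ σ s hs
  by_cases h0 : c.1 Δ σ s = 0
  · refine hc' ℓ h1 h2 Δ σ s fun h0' => hs ?_
    change c.1 Δ σ s + c'.1 Δ σ s = 0
    rw [h0, h0', add_zero]
  · exact hc ℓ h1 h2 Δ σ s h0

lemma Admissible.smul {p : LoosePerversity} {c : Sections K} (hc : Admissible p c) (a : ZMod 2) :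
    Admissible p (a • c) := by
  rw [admissible_iff] at *
  intro ℓ h1 h2 Δ σ s hs
  refine hc ℓ h1 h2 Δ σ s fun h0 => hs ?_
  change a * c.1 Δ σ s = 0
  rw [h0, mul_zero]

lemma Admissible.mono {p q : LoosePerversity} (hpq : p ≤ q) {c : Sections K}
    (hc : Admissible p c) : Admissible q c := by
  rw [admissible_iff] at *
  intro ℓ h1 h2 Δ σ s hs hs'
  exact (hc ℓ h1 h2 Δ σ s hs hs').trans (hpq ℓ)

/-- The global sections of degree `k` and of `p`-intersection: `c` and `δ c` are `p`-admissible. -/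
def intersection (K : FilteredFaceSet.{u} n) (p : LoosePerversity) (k : ℤ) :
    Submodule (ZMod 2) (Sections K) where
  carrier := {c | c ∈ degree K k ∧ Admissible p c ∧ Admissible p (coboundary c)}
  zero_mem' := ⟨zero_mem _, admissible_zero p, by rw [map_zero]; exact admissible_zero p⟩
  add_mem' hc hc' := ⟨add_mem hc.1 hc'.1, hc.2.1.add hc'.2.1, by
    rw [map_add]; exact hc.2.2.add hc'.2.2⟩
  smul_mem' a c hc := ⟨Submodule.smul_mem _ a hc.1, hc.2.1.smul a, by
    rw [map_smul]; exact hc.2.2.smul a⟩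

lemma coboundary_mem_intersection {p : LoosePerversity} {k k' : ℤ} (h : k + 1 = k')
    {c : Sections K} (hc : c ∈ intersection K p k) : coboundary c ∈ intersection K p k' := by
  subst h
  exact ⟨coboundary_mem_degree hc.1, hc.2.2, by
    rw [coboundary_coboundary]; exact admissible_zero p⟩

/-- The pull-back of global sections along a filtered face map. -/
def pullback (f : K ⟶ K') : Sections K' →ₗ[ZMod 2] Sections K where
  toFun c := ⟨fun Δ σ => c.1 Δ (f.app (op Δ.obj) σ), by
    intro Δ Δ' g σ
    have h : f.app (op Δ'.obj) (K.plus.map g.op σ) =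
        K'.plus.map g.op (f.app (op Δ.obj) σ) :=
      ConcreteCategory.congr_hom (f.naturality g.hom.op) σ
    change c.1 Δ' (f.app (op Δ'.obj) (K.plus.map g.op σ)) = _
    rw [h]
    exact c.2 Δ Δ' g _⟩
  map_add' _ _ := rfl
  map_smul' _ _ := rfl

lemma coboundary_pullback (f : K ⟶ K') (c : Sections K') :
    coboundary (pullback f c) = pullback f (coboundary c) := rfl

lemma pullback_mem_intersection (f : K ⟶ K') {p : LoosePerversity} {k : ℤ} {c : Sections K'}
    (hc : c ∈ intersection K' p k) : pullback f c ∈ intersection K p k := by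
  obtain ⟨h1, h2, h3⟩ := hc
  rw [admissible_iff] at h2 h3
  exact ⟨fun Δ σ s => h1 Δ _ s, admissible_iff.2 fun ℓ hℓ hℓ' Δ σ s => h2 ℓ hℓ hℓ' Δ _ s,
    admissible_iff.2 fun ℓ hℓ hℓ' Δ σ s => h3 ℓ hℓ hℓ' Δ _ s⟩

end Sections

/-! ## The generalized perverse cochain complex of a filtered face set -/

/-- Generalized perverse cochain complexes over `𝔽₂`: functors from the poset of loose perversities
to cochain complexes. -/
abbrev PerverseComplex := LoosePerversity ⥤ CochainComplex (ModuleCat.{u} (ZMod 2)) ℤ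

section Blowup

variable {n : ℕ}

/-- The cochain complex of the global sections of `p`-intersection. -/
def intersectionComplex (K : FilteredFaceSet.{u} n) (p : LoosePerversity) :
    CochainComplex (ModuleCat.{u} (ZMod 2)) ℤ where
  X k := ModuleCat.of (ZMod 2) (Sections.intersection K p k)
  d k k' := if h : k + 1 = k' then
    ModuleCat.ofHom (Sections.coboundary.restrict
      fun _ hc => Sections.coboundary_mem_intersection h hc) else 0
  shape k k' h := dif_neg h
  d_comp_d' i j k hij hjk := by
    have hij' : i + 1 = j := hij
    have hjk' : j + 1 = k := hjk
    rw [dif_pos hij', dif_pos hjk']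
    refine ModuleCat.hom_ext (LinearMap.ext fun c => Subtype.ext ?_)
    exact Sections.coboundary_coboundary c.1

/-- The generalized perverse cochain complex `p ↦ Ñ^*_p(K)`, the maps for `p ≤ q` being the
inclusions. -/
def blowup (K : FilteredFaceSet.{u} n) : PerverseComplex.{u} where
  obj p := intersectionComplex K p
  map {p q} hpq :=
    { f := fun k => ModuleCat.ofHom (Submodule.inclusion fun _ hc =>
        ⟨hc.1, hc.2.1.mono (leOfHom hpq), hc.2.2.mono (leOfHom hpq)⟩)
      comm' := fun i j hij => by
        have hij' : i + 1 = j := hij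
        simp only [intersectionComplex, dif_pos hij']
        rfl }

/-- The map of generalized perverse cochain complexes induced by a filtered face map. -/
def blowupMap {K K' : FilteredFaceSet.{u} n} (f : K ⟶ K') : blowup K' ⟶ blowup K where
  app p :=
    { f := fun k => ModuleCat.ofHom ((Sections.pullback f).restrict
        fun _ hc => Sections.pullback_mem_intersection f hc)
      comm' := fun i j hij => by
        have hij' : i + 1 = j := hij
        simp only [blowup, intersectionComplex, dif_pos hij']
        rfl }

/-- `K ↦ (p ↦ Ñ^*_p(K))` is a contravariant functor. -/
def blowupFunctor (n : ℕ) : (FilteredFaceSet.{u} n)ᵒᵖ ⥤ PerverseComplex.{u} where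
  obj K := blowup K.unop
  map f := blowupMap f.unop

/-- The global section underlying an element of `Ñ^k_p(K)`. -/
def toSections {K : (FilteredFaceSet.{u} n)ᵒᵖ} {p : LoosePerversity} {k : ℤ}
    (x : (((blowupFunctor n).obj K).obj p).X k) : Sections K.unop :=
  Subtype.val (p := fun c => c ∈ Sections.intersection K.unop p k) x

end Blowup

/-! ## Perverse `𝓔(2)`-algebras -/

/-- The component `𝓔(2)_i = 𝔽₂(e_i, τ_i)`, in any degree `i ≥ 0`: the basis element `e_i` has index
`false`, and `τ_i` has index `true`. -/
abbrev E2 : Type := Bool → ZMod 2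

namespace E2

/-- The generator `e_i`. -/
def e : E2 := Pi.single false 1

/-- The action of the generator of `Σ₂`, which exchanges `e_i` and `τ_i`. -/
def swap (g : E2) : E2 := fun b => g (!b)

/-- The differential `𝓔(2)_{i+1} → 𝓔(2)_i`, which sends both `e_{i+1}` and `τ_{i+1}` to
`e_i + τ_i`. -/
def d (g : E2) : E2 := fun _ => g false + g true

end E2

/-- A perverse `𝓔(2)`-algebra structure on a generalized perverse cochain complex `A`: a
`Σ₂`-equivariant cochain map `ψ : 𝓔(2) ⊗ A_p ⊗ A_q ⟶ A_{p+q}`, natural in `p` and `q`.  Here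
`𝓔(2)_i` is in degree `-i`, so that `ψ` maps `𝓔(2)_i ⊗ A_p^r ⊗ A_q^s` to `A_{p+q}^k`, with
`k = r + s - i`. -/
structure PerverseE2Structure (A : PerverseComplex.{u}) where
  ψ (p q : LoosePerversity) (i : ℕ) (r s k : ℤ) (h : k + i = r + s) :
    E2 →ₗ[ZMod 2] (A.obj p).X r →ₗ[ZMod 2] (A.obj q).X s →ₗ[ZMod 2] (A.obj (p + q)).X k
  /-- `ψ` commutes with the differentials, on `𝓔(2)_0`. -/
  cochain_zero (p q : LoosePerversity) (r s k : ℤ) (h : k = r + s) (g : E2)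
    (x : (A.obj p).X r) (y : (A.obj q).X s) :
    (A.obj (p + q)).d k (k + 1) (ψ p q 0 r s k (by simpa using h) g x y) =
      ψ p q 0 (r + 1) s (k + 1) (by push_cast; linarith) g ((A.obj p).d r (r + 1) x) y +
      ψ p q 0 r (s + 1) (k + 1) (by push_cast; linarith) g x ((A.obj q).d s (s + 1) y)
  /-- `ψ` commutes with the differentials, on `𝓔(2)_{i+1}`. -/
  cochain_succ (p q : LoosePerversity) (i : ℕ) (r s k : ℤ) (h : k + (i + 1) = r + s) (g : E2)
    (x : (A.obj p).X r) (y : (A.obj q).X s) :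
    (A.obj (p + q)).d k (k + 1) (ψ p q (i + 1) r s k (by push_cast; linarith) g x y) =
      ψ p q i r s (k + 1) (by linarith) (E2.d g) x y +
      ψ p q (i + 1) (r + 1) s (k + 1) (by push_cast; linarith) g
        ((A.obj p).d r (r + 1) x) y +
      ψ p q (i + 1) r (s + 1) (k + 1) (by push_cast; linarith) g
        x ((A.obj q).d s (s + 1) y)
  /-- `ψ` is `Σ₂`-equivariant (modulo the equality `A_{p+q} = A_{q+p}`). -/
  equivariant (p q : LoosePerversity) (i : ℕ) (r s k : ℤ) (h : k + i = r + s) (g : E2)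
    (x : (A.obj p).X r) (y : (A.obj q).X s) :
    (A.map (eqToHom (p.add_comm q))).f k (ψ p q i r s k h (E2.swap g) x y) =
      ψ q p i s r k (by linarith) g y x
  /-- `ψ` is natural in the perversities. -/
  natural (p p' q q' : LoosePerversity) (hp : p ≤ p') (hq : q ≤ q') (i : ℕ) (r s k : ℤ)
    (h : k + i = r + s) (g : E2) (x : (A.obj p).X r) (y : (A.obj q).X s) :
    (A.map (homOfLE (LoosePerversity.add_le_add hp hq))).f k (ψ p q i r s k h g x y) =
      ψ p' q' i r s k h g ((A.map (homOfLE hp)).f r x) ((A.map (homOfLE hq)).f s y)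

namespace PerverseE2Structure

variable {A : PerverseComplex.{u}}

/-- The perverse cup-`i` product `x ∪_i y = ψ(e_i ⊗ x ⊗ y)`, of degree `k = r + s - i`. -/
def cup (S : PerverseE2Structure A) {p q : LoosePerversity} (i : ℕ) {r s : ℤ} (k : ℤ)
    (h : k + i = r + s) (x : (A.obj p).X r) (y : (A.obj q).X s) : (A.obj (p + q)).X k :=
  S.ψ p q i r s k h E2.e x y

/-- A map `φ : A ⟶ B` of generalized perverse cochain complexes is a morphism of perverse
`𝓔(2)`-algebras if `φ (ψ(g ⊗ x ⊗ y)) = ψ(g ⊗ φ x ⊗ φ y)`. -/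
def IsMorphism {B : PerverseComplex.{u}} (S : PerverseE2Structure A) (T : PerverseE2Structure B)
    (φ : A ⟶ B) : Prop :=
  ∀ (p q : LoosePerversity) (i : ℕ) (r s k : ℤ) (h : k + i = r + s) (g : E2)
    (x : (A.obj p).X r) (y : (A.obj q).X s),
    (φ.app (p + q)).f k (S.ψ p q i r s k h g x y) =
      T.ψ p q i r s k h g ((φ.app p).f r x) ((φ.app q).f s y)

/-- Nice perverse `𝓔(2)`-algebras.  In (i), the element `x ∪_{|x|} x` of `A_{p+p}` and the element
`x` of `A_p` are compared in `A_q`, for any `q` above `p` and `p + p`. -/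
structure IsNice (S : PerverseE2Structure A) : Prop where
  cup_self (p q : LoosePerversity) (hp : p ≤ q) (hpp : p + p ≤ q) (r : ℕ) (x : (A.obj p).X r) :
    (A.map (homOfLE hpp)).f r (S.cup r r rfl x x) = (A.map (homOfLE hp)).f r x
  cup_eq_zero (p q : LoosePerversity) (i : ℕ) (r s k : ℤ) (h : k + i = r + s)
    (x : (A.obj p).X r) (y : (A.obj q).X s) : min r s < i → S.cup i k h x y = 0

end PerverseE2Structure

/-! ## Topological pseudomanifolds -/

/-- Metrizable topological manifolds of dimension `k` (possibly empty). -/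
def IsTopologicalManifold (k : ℕ) (M : Type u) [TopologicalSpace M] : Prop :=
  TopologicalSpace.MetrizableSpace M ∧ Nonempty (ChartedSpace (EuclideanSpace ℝ (Fin k)) M)

/-- The relation that identifies all the points of `L × {0}` with the summit. The summit is added
so that the cone on the empty space is a point. -/
inductive OpenCone.Rel (L : Type u) : (L × Set.Ico (0 : ℝ) 1) ⊕ Unit →
    (L × Set.Ico (0 : ℝ) 1) ⊕ Unit → Prop
  | base (x : L) : OpenCone.Rel L (Sum.inl (x, ⟨0, by simp⟩)) (Sum.inr ())

/-- The open cone `L × [0,1[ / L × {0}`, with the quotient topology. -/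
def OpenCone (L : Type u) : Type u := Quot (OpenCone.Rel L)

instance (L : Type u) [TopologicalSpace L] : TopologicalSpace (OpenCone L) :=
  inferInstanceAs (TopologicalSpace (Quot (OpenCone.Rel L)))

/-- The summit of the cone. -/
def OpenCone.summit (L : Type u) : OpenCone L := Quot.mk _ (Sum.inr ())

/-- The open cone on a subset of `L`, as a subset of the open cone on `L`. It contains the summit. -/
def OpenCone.sub {L : Type u} (S : Set L) : Set (OpenCone L) :=
  {z | z = OpenCone.summit L ∨ ∃ x ∈ S, ∃ t : Set.Ico (0 : ℝ) 1, z = Quot.mk _ (Sum.inl (x, t))}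

/-- `IsPseudomanifold d X F` says that the filtration `F` makes `X` a topological pseudomanifold of
dimension `n = d - 1` (the dimension `-1` is that of the empty space). The filtration is indexed
by `ℤ`, with `F i = ∅` for `i < 0` and `F i = X` for `i ≥ n`, and there is no stratum of
codimension one: `F (n - 1) = F (n - 2)`. -/
def IsPseudomanifold (d : ℕ) (X : Type u) [TopologicalSpace X] (F : ℤ → Set X) : Prop :=
  (∀ i < 0, F i = ∅) ∧ (∀ i, (d : ℤ) - 1 ≤ i → F i = Set.univ) ∧ Monotone F ∧
  (∀ i, IsClosed (F i)) ∧ F ((d : ℤ) - 2) = F ((d : ℤ) - 3) ∧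
  (∀ i : ℕ, i < d → IsTopologicalManifold i ↥(F i \ F ((i : ℤ) - 1))) ∧
  Dense (F ((d : ℤ) - 1) \ F ((d : ℤ) - 3)) ∧
  ∀ i : ℕ, i < d → ∀ x ∈ F i \ F ((i : ℤ) - 1),
    ∃ (V U : Set X) (L : Type u) (_ : TopologicalSpace L) (G : ℤ → Set L)
      (φ : ↥U × OpenCone L ≃ₜ ↥V),
      IsOpen V ∧ x ∈ V ∧
      (∃ W, IsOpen W ∧ U = W ∩ (F i \ F ((i : ℤ) - 1))) ∧ x ∈ U ∧
      CompactSpace L ∧ IsPseudomanifold (d - 1 - i) L G ∧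
      (∀ u : ↥U, (φ (u, OpenCone.summit L) : X) = u) ∧
      ∀ j : ℤ, -1 ≤ j →
        Subtype.val '' (φ '' (Set.univ ×ˢ OpenCone.sub (G j))) = V ∩ F (i + j + 1)
termination_by d
decreasing_by omega

/-- An `n`-dimensional topological pseudomanifold. -/
structure Pseudomanifold (n : ℕ) where
  carrier : Type u
  [topology : TopologicalSpace carrier]
  fil : ℤ → Set carrier
  isPseudomanifold : IsPseudomanifold (n + 1) carrier fil

attribute [instance] Pseudomanifold.topology

namespace Pseudomanifold

variable {n : ℕ}

/-- Stratum preserving maps: continuous maps with `f⁻¹(Y_{n-ℓ}) = X_{n-ℓ}` for all `ℓ ≥ 0`. -/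
@[ext]
structure Hom (X Y : Pseudomanifold.{u} n) where
  toMap : C(X.carrier, Y.carrier)
  preimage_fil : ∀ ℓ : ℕ, toMap ⁻¹' Y.fil ((n : ℤ) - ℓ) = X.fil ((n : ℤ) - ℓ)

instance : Category (Pseudomanifold.{u} n) where
  Hom := Hom
  id X := ⟨ContinuousMap.id _, fun _ => rfl⟩
  comp f g := ⟨g.toMap.comp f.toMap, fun ℓ => by
    rw [ContinuousMap.coe_comp, Set.preimage_comp, g.preimage_fil, f.preimage_fil]⟩

end Pseudomanifold

/-! ## The singular filtered face set -/

/-- The geometric join `Δ^{j₀} ∗ ⋯ ∗ Δ^{jₙ}`: the standard simplex on the disjoint union of the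
vertices of the factors. -/
abbrev FilteredSimplex.Realization {n : ℕ} (Δ : FilteredSimplex n) : Type :=
  stdSimplex ℝ (Σ i, Fin (Δ.size i))

/-- The face `Δ^{j₀} ∗ ⋯ ∗ Δ^{jᵢ}`. -/
def FilteredSimplex.face {n : ℕ} (Δ : FilteredSimplex n) (i : Fin (n + 1)) :
    Set Δ.Realization :=
  {t | ∀ v : Σ i, Fin (Δ.size i), i < v.1 → t v = 0}

/-- The affine map induced by a morphism. -/
def FilteredSimplex.realize {n : ℕ} {Δ Δ' : FilteredSimplex n} (f : Δ ⟶ Δ') :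
    C(Δ.Realization, Δ'.Realization) :=
  ⟨stdSimplex.map (Sigma.map id fun i => f i), stdSimplex.continuous_map _⟩

lemma FilteredSimplex.realize_preimage_face {n : ℕ} {Δ Δ' : FilteredSimplex n} (f : Δ ⟶ Δ')
    (i : Fin (n + 1)) : realize f ⁻¹' Δ'.face i = Δ.face i := by
  have happ : ∀ (t : Δ.Realization) (w : Σ i, Fin (Δ'.size i)),
      realize f t w = ∑ v with Sigma.map id (fun i => f i) v = w, t v := by
    intro t w
    have h := congrFun (stdSimplex.map_coe (Sigma.map id fun i => f i) t) w
    rw [FunOnFinite.linearMap_apply_apply] at h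
    exact h
  ext t
  simp only [Set.mem_preimage, face, Set.mem_ofPred_eq]
  constructor
  · intro h v hv
    have h' := h (Sigma.map id (fun i => f i) v) hv
    rw [happ, Finset.sum_eq_zero_iff_of_nonneg fun v _ => stdSimplex.zero_le t v] at h'
    exact h' v (by simp)
  · intro h w hw
    rw [happ]
    refine Finset.sum_eq_zero fun v hv => h v ?_
    rw [Finset.mem_filter] at hv
    rw [← hv.2] at hw
    exact hw

/-- The filtered singular simplices `σ : Δ^{j₀} ∗ ⋯ ∗ Δ^{jₙ} → X`, with
`σ⁻¹(X_i) = Δ^{j₀} ∗ ⋯ ∗ Δ^{jᵢ}` for all `i`. -/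
@[ext]
structure SingularSimplex {n : ℕ} (X : Pseudomanifold.{u} n) (Δ : FilteredSimplex n) where
  toMap : C(Δ.Realization, X.carrier)
  preimage_fil : ∀ i : Fin (n + 1), toMap ⁻¹' X.fil (i : ℕ) = Δ.face i

/-- The singular filtered face set of a pseudomanifold. -/
def singularFaceSet {n : ℕ} (X : Pseudomanifold.{u} n) : FilteredFaceSet.{u} n where
  obj Δ := SingularSimplex X Δ.unop
  map f := TypeCat.ofHom fun σ => ⟨σ.toMap.comp (FilteredSimplex.realize f.unop), fun i => by
    rw [ContinuousMap.coe_comp, Set.preimage_comp, σ.preimage_fil,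
      FilteredSimplex.realize_preimage_face]⟩
  map_id Δ := by
    refine ConcreteCategory.hom_ext _ _ fun σ => ?_
    apply SingularSimplex.ext
    ext t
    refine congrArg σ.toMap ?_
    exact stdSimplex.map_id_apply t
  map_comp f g := by
    refine ConcreteCategory.hom_ext _ _ fun σ => ?_
    apply SingularSimplex.ext
    ext t
    refine congrArg σ.toMap ?_
    refine Eq.trans ?_ (stdSimplex.map_comp_apply _ _ t).symm
    exact congrArg (fun h => stdSimplex.map h t) (funext fun _ => rfl)

/-- The functor `ISing^𝓕`, from pseudomanifolds and stratum preserving maps to filtered face sets. -/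
def singular (n : ℕ) : Pseudomanifold.{u} n ⥤ FilteredFaceSet.{u} n where
  obj X := singularFaceSet X
  map {X Y} f :=
    { app := fun Δ => TypeCat.ofHom fun σ => ⟨f.toMap.comp σ.toMap, fun i => by
        have h := f.preimage_fil (n - i)
        rw [Nat.cast_sub (Nat.lt_succ_iff.1 i.2), sub_sub_cancel] at h
        rw [ContinuousMap.coe_comp, Set.preimage_comp, h, σ.preimage_fil]⟩
      naturality := fun _ _ _ => rfl }

/-- The contravariant functor `X ↦ (p ↦ Ñ^*_p(ISing^𝓕(X)))`. -/
def intersectionCochains (n : ℕ) : (Pseudomanifold.{u} n)ᵒᵖ ⥤ PerverseComplex.{u} :=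
  (singular n).op ⋙ blowupFunctor n

/-- The component at the simplex `σ` of the global section underlying an element of
`Ñ^k_p(ISing^𝓕(X))`. -/
def component {n : ℕ} {X : Pseudomanifold.{u} n} {p : LoosePerversity} {k : ℤ}
    (x : (((intersectionCochains n).obj (op X)).obj p).X k) (Δ : RegularSimplex n)
    (σ : SingularSimplex X Δ.obj) : LocalCochain Δ.obj :=
  (toSections (K := op ((singular n).obj X)) x).1 Δ σ

end PerverseCochain

end

open CategoryTheory Opposite PerverseCochain

noncomputable section

namespace PerverseCochain

/-! The construction works for an arbitrary filtered face set; the theorem is its value on the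
singular one. Everything reduces to the coefficients of `a ⊗ b` in the diagonal of a tuple `s`.

The key is to replace the iterated product of diagonals by one diagonal. Order all vertices of the
tuple lexicographically, factor by factor. The `k`-th factor is twisted by the parity of `i₀ + ⋯ +
iₖ₋₁`, while the preceding factors contain `(i₀ + 1) + ⋯ + (iₖ₋₁ + 1)` common vertices of `a` and
`b`. The two numbers differ by `k`, so giving the vertices of factor `k` the weight `k` makes the
twist the parity of a position in the lexicographic order. Hence `cupCoeff i` is the coefficient of
a single weighted diagonal along `i + n + 1` common vertices (`cupCoeff_eq`).

The boundary formula then holds for any weight (`sum_diagonalCoeff_erase`). It rests on a count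
modulo 2: a sequence of bits has an even number of separators between a block of `true` and a block
of `false`, except that a nonempty constant sequence has exactly one (`sum_separating`). Transported
to tuples it gives the Leibniz rule for `∪ᵢ`. For `i = 0` the extra terms vanish because `a` and `b`
must meet in each of the `n + 1` factors (`Cell.inter_nonempty_of_isDiagonal`).

The same facts give the rest. Since `a ∪ b = s` and every factor has a common vertex, degrees in
each factor are subadditive and the apex cannot appear in `a` or `b` without appearing in `s`; so
perverse degrees add, and the Leibniz rule controls the coboundary of a product. Niceness follows by
counting common vertices. Naturality is immediate from the simplexwise formula. -/

/-! ## Diagonals on a totally ordered set of vertices -/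

section Diagonal

variable {V : Type} [LinearOrder V]

/-- The position of `v` relative to a set `I` of vertices, shifted by a weight `κ v`. -/
def position (κ : V → ℕ) (I : Finset V) (v : V) : ℕ := (I.filter (· < v)).card + κ v

/-- `A ⊗ B` occurs in the diagonal of `S` that splits `S` along `m` vertices, where the parity of
the position of a vertex is shifted by the weight `κ`. -/
def IsDiagonal (κ : V → ℕ) (m : ℕ) (A B S : Finset V) : Prop :=
  A ∪ B = S ∧ (A ∩ B).card = m ∧
    ∀ v ∈ A ∪ B, v ∉ A ∩ B → (v ∈ A ↔ Even (position κ (A ∩ B) v))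

open Classical in
/-- The coefficient of `A ⊗ B` in the weighted diagonal of `S`. -/
def diagonalCoeff (κ : V → ℕ) (m : ℕ) (A B S : Finset V) : ZMod 2 :=
  if IsDiagonal κ m A B S then 1 else 0

/-- A sum over the elements that separate a sequence of bits into a constant part equal to `true`
and a constant part equal to `false`. -/
lemma sum_separating (D : Finset V) (P : V → Prop) [DecidablePred P] :
    (∑ v ∈ D, if (∀ w ∈ D, w < v → P w) ∧ (∀ w ∈ D, v < w → ¬ P w) then (1 : ZMod 2) else 0) =
      (if ∀ w ∈ D, P w then 1 else 0) + (if ∀ w ∈ D, ¬ P w then 1 else 0) := by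
  -- The new maximum `M` separates exactly when `P` holds on all of `D`; an older vertex separates
  -- only if, in addition, `P M` fails.
  induction D using Finset.induction_on_max with
  | empty => simp [CharTwo.add_self_eq_zero]
  | insert M D hM ih =>
    have hMD : M ∉ D := fun h => lt_irrefl _ (hM M h)
    rw [Finset.sum_insert hMD]
    have h1 : ((∀ w ∈ insert M D, w < M → P w) ∧ (∀ w ∈ insert M D, M < w → ¬ P w)) ↔
        ∀ w ∈ D, P w := by
      constructor
      · intro h w hw
        exact h.1 w (Finset.mem_insert_of_mem hw) (hM w hw)
      · refine fun h => ⟨fun w hw hwM => ?_, fun w hw hwM => ?_⟩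
        · rcases Finset.mem_insert.1 hw with rfl | hw
          · exact absurd hwM (lt_irrefl _)
          · exact h w hw
        · rcases Finset.mem_insert.1 hw with rfl | hw
          · exact absurd hwM (lt_irrefl _)
          · exact absurd hwM (hM w hw).not_gt
    have h2 : ∀ v ∈ D, ((∀ w ∈ insert M D, w < v → P w) ∧ (∀ w ∈ insert M D, v < w → ¬ P w)) ↔
        ((∀ w ∈ D, w < v → P w) ∧ (∀ w ∈ D, v < w → ¬ P w)) ∧ ¬ P M := by
      intro v hv
      simp only [Finset.forall_mem_insert]
      have := hM v hv
      have := this.not_gt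
      tauto
    rw [if_congr h1 rfl rfl, Finset.sum_congr rfl fun v hv => if_congr (h2 v hv) rfl rfl]
    simp only [Finset.forall_mem_insert]
    by_cases hP : P M
    · simp [hP]
    · simp only [hP, not_false_eq_true, and_true, true_and, false_and, if_false, zero_add, ih]
      -- The indicator of "`P` on all of `D`" occurs twice, once from `M` and once from the
      -- induction hypothesis.
      rw [← add_assoc, CharTwo.add_self_eq_zero, zero_add]

lemma position_insert_of_lt (κ : V → ℕ) {I : Finset V} {v w : V} (hv : v ∉ I) (h : v < w) :
    position κ (insert v I) w = position κ I w + 1 := by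
  unfold position
  rw [Finset.filter_insert, if_pos h, Finset.card_insert_of_notMem (by simp [hv])]
  ring

lemma position_insert_of_not_lt (κ : V → ℕ) {I : Finset V} {v w : V} (h : ¬ v < w) :
    position κ (insert v I) w = position κ I w := by
  unfold position
  rw [Finset.filter_insert, if_neg h]

/-- A vertex outside the intersection lies in exactly one factor, so exchanging the factors negates
every parity condition. In this form both end terms of the boundary formula are the constant cases
of `sum_separating`. -/
lemma isDiagonal_swap {κ : V → ℕ} {m : ℕ} {A B S : Finset V} :
    IsDiagonal κ m B A S ↔ A ∪ B = S ∧ (A ∩ B).card = m ∧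
      ∀ v ∈ A ∪ B, v ∉ A ∩ B → ¬ (v ∈ A ↔ Even (position κ (A ∩ B) v)) := by
  unfold IsDiagonal
  rw [Finset.union_comm B A, Finset.inter_comm B A]
  refine and_congr_right fun _ => and_congr_right fun _ => forall_congr' fun v =>
    imp_congr_right fun h1 => imp_congr_right fun h2 => ?_
  rw [Finset.mem_union] at h1
  rw [Finset.mem_inter] at h2
  tauto

/-- Enlarging the intersection by a vertex `v`. -/
lemma isDiagonal_iff_separating {κ : V → ℕ} {m : ℕ} {A B A' B' : Finset V} {v : V}
    (hv' : v ∉ A ∩ B) (hU : A' ∪ B' = A ∪ B) (hI : A' ∩ B' = insert v (A ∩ B))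
    (hA : ∀ w, w ≠ v → (w ∈ A' ↔ w ∈ A)) :
    IsDiagonal κ (m + 1) A' B' (A ∪ B) ↔ (A ∩ B).card = m ∧
      (∀ w ∈ (A ∪ B) \ (A ∩ B), w < v → (w ∈ A ↔ Even (position κ (A ∩ B) w))) ∧
      (∀ w ∈ (A ∪ B) \ (A ∩ B), v < w → ¬ (w ∈ A ↔ Even (position κ (A ∩ B) w))) := by
  unfold IsDiagonal
  rw [hU, hI, Finset.card_insert_of_notMem hv', Nat.add_right_cancel_iff]
  simp only [true_and]
  refine and_congr_right fun _ => ?_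
  constructor
  · refine fun h => ⟨fun w hw hwv => ?_, fun w hw hwv => ?_⟩
    · rw [Finset.mem_sdiff] at hw
      have := h w hw.1 (by rw [Finset.mem_insert, not_or]; exact ⟨hwv.ne, hw.2⟩)
      rwa [hA w hwv.ne, position_insert_of_not_lt κ hwv.not_gt] at this
    · rw [Finset.mem_sdiff] at hw
      have := h w hw.1 (by rw [Finset.mem_insert, not_or]; exact ⟨hwv.ne', hw.2⟩)
      -- Beyond `v` the position grows by one, so the vertices there must violate the original
      -- condition.
      rw [hA w hwv.ne', position_insert_of_lt κ hv' hwv, Nat.even_add_one] at this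
      tauto
  · rintro ⟨h1, h2⟩ w hw hw'
    rw [Finset.mem_insert, not_or] at hw'
    rw [hA w hw'.1]
    rcases lt_or_gt_of_ne hw'.1 with h | h
    · rw [position_insert_of_not_lt κ h.not_gt]
      exact h1 w (Finset.mem_sdiff.2 ⟨hw, hw'.2⟩) h
    · rw [position_insert_of_lt κ hv' h, Nat.even_add_one]
      have := h2 w (Finset.mem_sdiff.2 ⟨hw, hw'.2⟩) h
      tauto

/-- Adding a new vertex to exactly one of the two factors. -/
lemma isDiagonal_insert_iff {κ : V → ℕ} {m : ℕ} {A B A' B' : Finset V} {v : V}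
    (hv : v ∉ A ∪ B) (hU : A' ∪ B' = insert v (A ∪ B)) (hI : A' ∩ B' = A ∩ B)
    (hA : ∀ w, w ≠ v → (w ∈ A' ↔ w ∈ A)) :
    IsDiagonal κ m A' B' (insert v (A ∪ B)) ↔ IsDiagonal κ m A B (A ∪ B) ∧
      (v ∈ A' ↔ Even (position κ (A ∩ B) v)) := by
  unfold IsDiagonal
  rw [hU, hI]
  have hv' : v ∉ A ∩ B := fun h => hv (Finset.mem_union_left _ (Finset.mem_inter.1 h).1)
  simp only [true_and, Finset.forall_mem_insert, hv', not_false_eq_true, true_implies]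
  rw [and_assoc]
  refine and_congr_right fun _ => ?_
  rw [and_comm]
  refine and_congr_left fun _ => forall_congr' fun w => imp_congr_right fun hw => ?_
  rw [hA w (by rintro rfl; exact hv hw)]

/-- Both sums make a vertex `v` of the symmetric difference common. The result is a diagonal exactly
when `v` separates correctly placed vertices from misplaced ones, so `sum_separating` leaves the two
cases "all correct" and "all misplaced", the latter being the swapped diagonal. -/
lemma sum_diagonalCoeff_of_eq (κ : V → ℕ) (m : ℕ) (A B : Finset V) :
    (∑ v ∈ (A ∪ B) \ A, diagonalCoeff κ (m + 1) (insert v A) B (A ∪ B)) +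
      (∑ v ∈ (A ∪ B) \ B, diagonalCoeff κ (m + 1) A (insert v B) (A ∪ B)) =
      diagonalCoeff κ m A B (A ∪ B) + diagonalCoeff κ m B A (A ∪ B) := by
  classical
  have hD : (A ∪ B) \ (A ∩ B) = ((A ∪ B) \ A) ∪ ((A ∪ B) \ B) := Finset.sdiff_inter_distrib_right _ _ _
  have hdisj : Disjoint ((A ∪ B) \ A) ((A ∪ B) \ B) := by
    rw [Finset.disjoint_left]
    intro v h1 h2
    simp only [Finset.mem_sdiff, Finset.mem_union] at h1 h2
    tauto
  have key := sum_separating ((A ∪ B) \ (A ∩ B)) fun w => (w ∈ A ↔ Even (position κ (A ∩ B) w))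
  have hL : ∀ v ∈ (A ∪ B) \ A, IsDiagonal κ (m + 1) (insert v A) B (A ∪ B) ↔ (A ∩ B).card = m ∧
      (∀ w ∈ (A ∪ B) \ (A ∩ B), w < v → (w ∈ A ↔ Even (position κ (A ∩ B) w))) ∧
      (∀ w ∈ (A ∪ B) \ (A ∩ B), v < w → ¬ (w ∈ A ↔ Even (position κ (A ∩ B) w))) := fun v hv => by
    rw [Finset.mem_sdiff, Finset.mem_union] at hv
    have hvB : v ∈ B := hv.1.resolve_left hv.2
    exact isDiagonal_iff_separating
      (fun h => hv.2 (Finset.mem_inter.1 h).1)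
      (by rw [Finset.insert_union, Finset.insert_eq_self.2 (Finset.mem_union_right _ hvB)])
      (by rw [Finset.insert_inter_of_mem hvB])
      (fun w hw => by simp [hw])
  have hR : ∀ v ∈ (A ∪ B) \ B, IsDiagonal κ (m + 1) A (insert v B) (A ∪ B) ↔ (A ∩ B).card = m ∧
      (∀ w ∈ (A ∪ B) \ (A ∩ B), w < v → (w ∈ A ↔ Even (position κ (A ∩ B) w))) ∧
      (∀ w ∈ (A ∪ B) \ (A ∩ B), v < w → ¬ (w ∈ A ↔ Even (position κ (A ∩ B) w))) := fun v hv => by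
    rw [Finset.mem_sdiff, Finset.mem_union] at hv
    have hvA : v ∈ A := hv.1.resolve_right hv.2
    exact isDiagonal_iff_separating
      (fun h => hv.2 (Finset.mem_inter.1 h).2)
      (by rw [Finset.union_insert, Finset.insert_eq_self.2 (Finset.mem_union_left _ hvA)])
      (by rw [Finset.inter_insert_of_mem hvA])
      (fun w hw => Iff.rfl)
  unfold diagonalCoeff
  rw [Finset.sum_congr rfl fun v hv => if_congr (hL v hv) rfl rfl,
    Finset.sum_congr rfl fun v hv => if_congr (hR v hv) rfl rfl, ← Finset.sum_union hdisj, ← hD,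
    if_congr (isDiagonal_swap (A := A) (B := B)) rfl rfl]
  unfold IsDiagonal
  by_cases hm : (A ∩ B).card = m
  · simp only [hm, true_and]
    rw [key]
    simp only [Finset.mem_sdiff, and_imp]
  · simp [hm]

/-- The parity of the position of `v` decides which factor `v` must join, so exactly one of the two
placements is allowed. -/
lemma diagonalCoeff_insert_add (κ : V → ℕ) (m : ℕ) {A B : Finset V} {v : V} (hv : v ∉ A ∪ B) :
    diagonalCoeff κ m (insert v A) B (insert v (A ∪ B)) +
      diagonalCoeff κ m A (insert v B) (insert v (A ∪ B)) = diagonalCoeff κ m A B (A ∪ B) := by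
  classical
  have hv' := hv
  rw [Finset.mem_union, not_or] at hv'
  unfold diagonalCoeff
  rw [if_congr (isDiagonal_insert_iff hv (Finset.insert_union _ _ _)
      (Finset.insert_inter_of_notMem hv'.2) fun w hw => by simp [hw]) rfl rfl,
    if_congr (isDiagonal_insert_iff hv (Finset.union_insert _ _ _)
      (Finset.inter_insert_of_notMem hv'.1) fun w _ => Iff.rfl) rfl rfl]
  by_cases h : IsDiagonal κ m A B (A ∪ B) <;> by_cases h2 : Even (position κ (A ∩ B) v) <;>
    simp [h, h2, hv'.1]

lemma diagonalCoeff_eq_zero {κ : V → ℕ} {m : ℕ} {A B S : Finset V} (h : A ∪ B ≠ S) :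
    diagonalCoeff κ m A B S = 0 :=
  if_neg fun h' => h h'.1

/-- The boundary formula for the weighted diagonals. -/
lemma sum_diagonalCoeff_erase (κ : V → ℕ) (m : ℕ) (A B S : Finset V) :
    ∑ v ∈ S, diagonalCoeff κ (m + 1) A B (S.erase v) =
      diagonalCoeff κ m A B S + diagonalCoeff κ m B A S +
      ∑ v ∈ S \ A, diagonalCoeff κ (m + 1) (insert v A) B S +
      ∑ v ∈ S \ B, diagonalCoeff κ (m + 1) A (insert v B) S := by
  -- Nonzero terms require `A ∪ B` to be `S`, or `S` with a single vertex removed.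
  by_cases hS : A ∪ B = S
  · subst hS
    rw [add_assoc, sum_diagonalCoeff_of_eq, CharTwo.add_self_eq_zero]
    refine Finset.sum_eq_zero fun v hv => diagonalCoeff_eq_zero fun h => ?_
    rw [h] at hv
    exact Finset.notMem_erase v _ hv
  rw [diagonalCoeff_eq_zero hS, diagonalCoeff_eq_zero (by rwa [Finset.union_comm]), add_zero,
    zero_add]
  by_cases h : ∃ v, v ∉ A ∪ B ∧ insert v (A ∪ B) = S
  · obtain ⟨v, hv, rfl⟩ := h
    have hv' := hv
    rw [Finset.mem_union, not_or] at hv'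
    have hvS := Finset.mem_insert_self v (A ∪ B)
    rw [Finset.sum_eq_single_of_mem v hvS, Finset.erase_insert hv,
      Finset.sum_eq_single_of_mem v (Finset.mem_sdiff.2 ⟨hvS, hv'.1⟩),
      Finset.sum_eq_single_of_mem v (Finset.mem_sdiff.2 ⟨hvS, hv'.2⟩),
      diagonalCoeff_insert_add κ (m + 1) hv]
    · intro w _ hwv
      refine diagonalCoeff_eq_zero fun h => ?_
      rw [Finset.union_insert] at h
      rw [← h, Finset.mem_insert] at hvS
      exact hvS.elim (fun h => hwv h.symm) hv
    · intro w _ hwv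
      refine diagonalCoeff_eq_zero fun h => ?_
      rw [Finset.insert_union] at h
      rw [← h, Finset.mem_insert] at hvS
      exact hvS.elim (fun h => hwv h.symm) hv
    · intro w _ hwv
      refine diagonalCoeff_eq_zero fun h => hv ?_
      rw [h]
      exact Finset.mem_erase.2 ⟨hwv.symm, hvS⟩
  · push Not at h
    rw [Finset.sum_eq_zero, Finset.sum_eq_zero, Finset.sum_eq_zero, add_zero]
    · intro w hw
      refine diagonalCoeff_eq_zero fun h' => ?_
      rw [Finset.union_insert] at h'
      by_cases hwU : w ∈ A ∪ B
      · exact hS (by rwa [Finset.insert_eq_self.2 hwU] at h')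
      · exact h w hwU h'
    · intro w hw
      refine diagonalCoeff_eq_zero fun h' => ?_
      rw [Finset.insert_union] at h'
      by_cases hwU : w ∈ A ∪ B
      · exact hS (by rwa [Finset.insert_eq_self.2 hwU] at h')
      · exact h w hwU h'
    · intro w hw
      refine diagonalCoeff_eq_zero fun h' => ?_
      exact h w (by rw [h']; exact Finset.notMem_erase w S) (by rw [h', Finset.insert_erase hw])

end Diagonal

/-! ## The diagonal of a tuple of simplices as a diagonal for the lexicographic order -/

/-- The parity twist in the iterated diagonal is a weight. -/
lemma ite_steenrodCoeff {V : Type} [LinearOrder V] (e j : ℕ) (a b s : Finset V) :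
    (if Even e then steenrodCoeff j a b s else steenrodCoeff j b a s) =
      diagonalCoeff (fun _ => e) (j + 1) a b s := by
  unfold steenrodCoeff diagonalCoeff
  by_cases he : Even e
  · rw [if_pos he]
    congr 1
    refine propext ?_
    unfold IsDiagonal position
    refine and_congr_right fun _ => and_congr_right fun _ => ?_
    simp only [Nat.even_add, he, iff_true, Finset.mem_sdiff, Finset.mem_union, Finset.mem_inter]
    constructor
    · rintro ⟨h1, h2⟩ v hv hv'
      have h1 := h1 v
      have h2 := h2 v
      rw [← Nat.not_even_iff_odd] at h2
      tauto
    · refine fun h => ⟨fun v hv => ?_, fun v hv => ?_⟩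
      · exact (h v (Or.inl hv.1) fun h' => hv.2 h'.2).1 hv.1
      · rw [← Nat.not_even_iff_odd]
        exact fun h' => hv.2 ((h v (Or.inr hv.1) fun h' => hv.2 h'.1).2 h')
  -- For odd `e`, exchanging the factors and shifting every position by `e` both negate the parity
  -- condition.
  · rw [if_neg he, Finset.union_comm b a, Finset.inter_comm b a]
    congr 1
    refine propext ?_
    unfold IsDiagonal position
    refine and_congr_right fun _ => and_congr_right fun _ => ?_
    simp only [Nat.even_add, he, iff_false, Finset.mem_sdiff, Finset.mem_union, Finset.mem_inter]
    constructor
    · rintro ⟨h1, h2⟩ v hv hv'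
      have h1 := h1 v
      have h2 := h2 v
      rw [← Nat.not_even_iff_odd] at h2
      tauto
    · refine fun h => ⟨fun v hv => ?_, fun v hv => ?_⟩
      · by_contra h'
        exact hv.2 ((h v (Or.inr hv.1) fun h' => hv.2 h'.1).2 h')
      · rw [← Nat.not_even_iff_odd]
        exact (h v (Or.inl hv.1) fun h' => hv.2 h'.2).1 hv.1

variable {n : ℕ} {Δ Δ' : FilteredSimplex n}

/-- The vertices of all the simplices. -/
def Vertex (Δ : FilteredSimplex n) : Type := Lex (Σ k, WithTop (Fin (Δ.size k)))

/-- The lexicographic order. -/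
instance : LinearOrder (Vertex Δ) :=
  inferInstanceAs (LinearOrder (Lex (Σ k, WithTop (Fin (Δ.size k)))))

/-- The vertex `v` of the `k`-th simplex. -/
def Vertex.mk (k : Fin (n + 1)) (v : WithTop (Fin (Δ.size k))) : Vertex Δ := toLex ⟨k, v⟩

/-- The index of the factor of a vertex. -/
def Vertex.weight (x : Vertex Δ) : ℕ := (ofLex x).1

/-- The set of vertices of a tuple of sets. -/
def flatten (f : ∀ k, Finset (WithTop (Fin (Δ.size k)))) : Finset (Vertex Δ) :=
  (Finset.univ.sigma f).map toLex.toEmbedding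

lemma mk_mem_flatten {f : ∀ k, Finset (WithTop (Fin (Δ.size k)))} {k : Fin (n + 1)}
    {v : WithTop (Fin (Δ.size k))} : Vertex.mk k v ∈ flatten f ↔ v ∈ f k := by
  unfold flatten Vertex.mk
  refine Iff.trans (Finset.mem_map' toLex.toEmbedding) ?_
  rw [Finset.mem_sigma]
  exact and_iff_right (Finset.mem_univ _)

lemma forall_vertex {P : Vertex Δ → Prop} : (∀ x, P x) ↔ ∀ k v, P (Vertex.mk k v) :=
  ⟨fun h _ _ => h _, fun h x => h (ofLex x).1 (ofLex x).2⟩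

lemma flatten_subset {f g : ∀ k, Finset (WithTop (Fin (Δ.size k)))} :
    flatten f ⊆ flatten g ↔ ∀ k, f k ⊆ g k := by
  refine forall_vertex.trans (forall_congr' fun k => forall_congr' fun v => ?_)
  rw [mk_mem_flatten, mk_mem_flatten]

lemma flatten_injective :
    Function.Injective (flatten : (∀ k, Finset (WithTop (Fin (Δ.size k)))) → _) := by
  intro f g h
  funext k
  exact (flatten_subset.1 h.subset k).antisymm (flatten_subset.1 h.symm.subset k)

lemma flatten_union (f g : ∀ k, Finset (WithTop (Fin (Δ.size k)))) :
    flatten f ∪ flatten g = flatten fun k => f k ∪ g k := by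
  refine Finset.ext (forall_vertex.2 fun k v => ?_)
  simp only [Finset.mem_union, mk_mem_flatten]

lemma flatten_inter (f g : ∀ k, Finset (WithTop (Fin (Δ.size k)))) :
    flatten f ∩ flatten g = flatten fun k => f k ∩ g k := by
  refine Finset.ext (forall_vertex.2 fun k v => ?_)
  simp only [Finset.mem_inter, mk_mem_flatten]

lemma card_flatten (f : ∀ k, Finset (WithTop (Fin (Δ.size k)))) :
    (flatten f).card = ∑ k, (f k).card :=
  (Finset.card_map _).trans (Finset.card_sigma _ _)

lemma mk_lt_mk {k l : Fin (n + 1)} {v : WithTop (Fin (Δ.size k))}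
    {w : WithTop (Fin (Δ.size l))} :
    (Vertex.mk l w : Vertex Δ) < Vertex.mk k v ↔ l < k ∨ ∃ h : l = k, h ▸ w < v :=
  Sigma.Lex.lt_def

/-- Below a vertex of factor `k` lie all vertices of the earlier factors and none of the later ones;
the final `k` is the weight. -/
lemma position_flatten (f : ∀ k, Finset (WithTop (Fin (Δ.size k)))) (k : Fin (n + 1))
    (v : WithTop (Fin (Δ.size k))) :
    position Vertex.weight (flatten f) (Vertex.mk k v) =
      ∑ l with l < k, (f l).card + ((f k).filter (· < v)).card + k := by
  have hk : Vertex.weight (Vertex.mk k v) = k := rfl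
  unfold position
  rw [hk]
  congr 1
  have h : (flatten f).filter (· < Vertex.mk k v) =
      flatten fun l => (f l).filter fun w => Vertex.mk l w < Vertex.mk k v := by
    refine Finset.ext (forall_vertex.2 fun k v => ?_)
    rw [Finset.mem_filter, mk_mem_flatten, mk_mem_flatten, Finset.mem_filter]
  rw [h, card_flatten, ← Finset.sum_filter_add_sum_filter_not Finset.univ (· < k)]
  congr 1
  · refine Finset.sum_congr rfl fun l hl => ?_
    rw [Finset.mem_filter] at hl
    rw [Finset.filter_true_of_mem fun w _ => mk_lt_mk.2 (Or.inl hl.2)]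
  · rw [Finset.sum_eq_single_of_mem k (by simp)]
    · congr 1
      refine Finset.filter_congr fun w _ => ?_
      rw [mk_lt_mk]
      simp
    · intro l hl hlk
      rw [Finset.mem_filter] at hl
      rw [Finset.card_eq_zero, Finset.filter_false_of_mem]
      intro w _ hw
      rw [mk_lt_mk] at hw
      rcases hw with hw | ⟨hw, -⟩
      · exact hl.2 hw
      · exact hlk hw

/-! ### Tuples as sets of vertices, and sums over their facets -/

namespace Cell

/-- The set of vertices of a tuple. -/
def flat (s : Cell Δ) : Finset (Vertex Δ) := flatten s.simplex

lemma flat_injective : Function.Injective (flat : Cell Δ → _) :=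
  flatten_injective.comp simplex_injective

lemma dim_eq (s : Cell Δ) : s.dim = s.flat.card - (n + 1) := by
  unfold flat
  rw [card_flatten]
  simp [dim, dimAt]

/-- The lower bound keeps every factor nonempty; the upper bound keeps the apex out of the last one.
-/
lemma exists_flat_eq {a s : Cell Δ} {T : Finset (Vertex Δ)} (ha : a.flat ⊆ T) (hs : T ⊆ s.flat) :
    ∃ t : Cell Δ, t.flat = T := by
  classical
  have hT : flatten (fun k => Finset.univ.filter fun v => Vertex.mk k v ∈ T) = T := by
    refine Finset.ext (forall_vertex.2 fun k v => ?_)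
    rw [mk_mem_flatten, Finset.mem_filter]
    exact and_iff_right (Finset.mem_univ _)
  rw [← hT] at ha hs
  refine ⟨⟨_, fun k => (a.nonempty k).mono (flatten_subset.1 ha k), fun h => ?_⟩, hT⟩
  exact s.top_notMem (flatten_subset.1 hs _ h)

lemma isFacet_iff_covBy {s t : Cell Δ} : t.IsFacet s ↔ t.flat ⋖ s.flat := by
  unfold IsFacet
  rw [← flatten_subset, Finset.covBy_iff_card_sdiff_eq_one, dim_eq, dim_eq]
  refine and_congr_right fun h => ?_
  have h' : t.flat ⊆ s.flat := h
  have := Finset.card_le_card h'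
  rw [Finset.card_sdiff_of_subset h']
  omega

/-- A sum over the facets of a tuple. -/
lemma sum_isFacet (a s : Cell Δ) (F : Finset (Vertex Δ) → ZMod 2) (hF : ∀ T, F T ≠ 0 → a.flat ⊆ T)
    [DecidablePred fun t : Cell Δ => t.IsFacet s] :
    ∑ t : Cell Δ with t.IsFacet s, F t.flat = ∑ v ∈ s.flat, F (s.flat.erase v) := by
  rw [← Finset.sum_image (f := F) (g := s.flat.erase) (Finset.erase_injOn _)]
  refine Finset.sum_of_injOn flat flat_injective.injOn ?_ ?_ fun _ _ => rfl
  · intro t ht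
    rw [Finset.mem_coe, Finset.mem_filter, isFacet_iff_covBy, Finset.covBy_iff_exists_erase] at ht
    obtain ⟨-, v, hv, h⟩ := ht
    exact Finset.mem_coe.2 (Finset.mem_image.2 ⟨v, hv, h⟩)
  -- Erasing a vertex may empty a factor, so that no tuple corresponds to `T`; then `T` cannot
  -- contain `a.flat` and its term is zero.
  · intro T hT hT'
    by_contra h
    obtain ⟨v, hv, rfl⟩ := Finset.mem_image.1 hT
    obtain ⟨t, ht⟩ := exists_flat_eq (hF _ h) (Finset.erase_subset v s.flat)
    refine hT' ⟨t, ?_, ht⟩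
    rw [Finset.mem_coe, Finset.mem_filter, isFacet_iff_covBy, Finset.covBy_iff_exists_erase]
    exact ⟨Finset.mem_univ _, v, hv, ht.symm⟩

/-- A sum over the tuples that have a given facet. -/
lemma sum_isFacet_of (a s : Cell Δ) (F : Finset (Vertex Δ) → ZMod 2)
    (hF : ∀ T, F T ≠ 0 → T ⊆ s.flat) [DecidablePred fun t : Cell Δ => a.IsFacet t] :
    ∑ t : Cell Δ with a.IsFacet t, F t.flat = ∑ v ∈ s.flat \ a.flat, F (insert v a.flat) := by
  have hinj : Set.InjOn (fun v => insert v a.flat) ↑(s.flat \ a.flat) := by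
    intro v hv w _ h
    rw [Finset.mem_coe, Finset.mem_sdiff] at hv
    exact (Finset.insert_inj hv.2).1 h
  rw [← Finset.sum_image hinj, ← Finset.sum_filter_of_ne fun t _ h => hF t.flat h]
  refine Finset.sum_of_injOn flat flat_injective.injOn ?_ ?_ fun _ _ => rfl
  · intro t ht
    rw [Finset.mem_coe, Finset.mem_filter, Finset.mem_filter, isFacet_iff_covBy,
      Finset.covBy_iff_exists_insert] at ht
    obtain ⟨⟨-, v, hv, h⟩, hts⟩ := ht
    rw [← h] at hts
    exact Finset.mem_coe.2 (Finset.mem_image.2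
      ⟨v, Finset.mem_sdiff.2 ⟨hts (Finset.mem_insert_self _ _), hv⟩, h⟩)
  · intro T hT hT'
    by_contra h
    obtain ⟨v, hv, rfl⟩ := Finset.mem_image.1 hT
    obtain ⟨t, ht⟩ := exists_flat_eq (Finset.subset_insert v a.flat) (hF _ h)
    refine hT' ⟨t, ?_, ht⟩
    rw [Finset.mem_coe, Finset.mem_filter, Finset.mem_filter, isFacet_iff_covBy,
      Finset.covBy_iff_exists_insert, ht]
    exact ⟨⟨Finset.mem_univ _, v, (Finset.mem_sdiff.1 hv).2, rfl⟩, hF _ h⟩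

/-- Without a common vertex in factor `k`, all positions in that factor are equal, so its vertices
all lie on the same side. This contradicts the nonemptiness of both `a.simplex k` and `b.simplex k`.
-/
lemma inter_nonempty_of_isDiagonal {m : ℕ} {a b : Cell Δ} {S : Finset (Vertex Δ)}
    (h : IsDiagonal Vertex.weight m a.flat b.flat S) (k : Fin (n + 1)) :
    (a.simplex k ∩ b.simplex k).Nonempty := by
  rw [Finset.nonempty_iff_ne_empty]
  intro h0
  obtain ⟨v, hv⟩ := a.nonempty k
  obtain ⟨w, hw⟩ := b.nonempty k
  have hnot : ∀ x, ¬ (x ∈ a.simplex k ∧ x ∈ b.simplex k) := fun x hx => by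
    have := Finset.mem_inter.2 hx
    simp [h0] at this
  obtain ⟨-, -, h⟩ := h
  unfold flat at h
  rw [flatten_union, flatten_inter, forall_vertex] at h
  have hv' := h k v
  have hw' := h k w
  rw [mk_mem_flatten, mk_mem_flatten, mk_mem_flatten, position_flatten, h0,
    Finset.mem_union] at hv' hw'
  have h1 := (hv' (Or.inl hv) (by simp)).1 hv
  have h2 := (hw' (Or.inr hw) (by simp)).2 (by simpa using h1)
  exact hnot w ⟨h2, hw⟩

/-- The diagonals of the factors, twisted by the preceding degrees `I`, make up a diagonal for the
lexicographic order. -/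
lemma forall_isDiagonal_iff (I : Fin (n + 1) → ℕ) (a b s : Cell Δ) :
    (∀ k, IsDiagonal (fun _ => ∑ l with l < k, I l) (I k + 1) (a.simplex k) (b.simplex k)
      (s.simplex k)) ↔
      (∀ k, (a.simplex k ∩ b.simplex k).card = I k + 1) ∧
        IsDiagonal Vertex.weight (∑ k, I k + n + 1) a.flat b.flat s.flat := by
  unfold IsDiagonal flat
  rw [flatten_union, flatten_inter, flatten_injective.eq_iff, card_flatten, funext_iff,
    forall_vertex, forall_and, forall_and, and_left_comm]
  refine and_congr_right fun hcard => and_congr_right fun _ => ?_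
  have hsum : ∑ k, (a.simplex k ∩ b.simplex k).card = ∑ k, I k + n + 1 := by
    simp [hcard, Finset.sum_add_distrib, add_assoc]
  rw [and_iff_right hsum]
  refine forall_congr' fun k => forall_congr' fun v => ?_
  rw [mk_mem_flatten, mk_mem_flatten, mk_mem_flatten, position_flatten]
  -- The excess `k`, one for each earlier factor, cancels modulo 2 against the weight `k`.
  have hk : ∑ l with l < k, (a.simplex l ∩ b.simplex l).card = ∑ l with l < k, I l + k := by
    rw [Finset.sum_congr rfl fun l _ => hcard l, Finset.sum_add_distrib, Finset.sum_const,
      smul_eq_mul, mul_one, Finset.filter_gt_eq_Iio, Fin.card_Iio]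
  rw [hk]
  refine imp_congr_right fun _ => imp_congr_right fun _ => iff_congr Iff.rfl ?_
  unfold position
  simp only [Nat.even_add]
  tauto

end Cell

/-- At most one multi-index contributes, because `I k + 1` must be the number of common vertices in
factor `k`. -/
lemma cupCoeff_eq (i : ℕ) (a b s : Cell Δ) :
    cupCoeff i a b s = diagonalCoeff Vertex.weight (i + n + 1) a.flat b.flat s.flat := by
  classical
  have h1 : cupCoeff i a b s = ∑ I ∈ Finset.piAntidiag Finset.univ i,
      if (∀ k, (a.simplex k ∩ b.simplex k).card = I k + 1) ∧
        IsDiagonal Vertex.weight (i + n + 1) a.flat b.flat s.flat then (1 : ZMod 2) else 0 := by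
    unfold cupCoeff
    refine Finset.sum_congr rfl fun I hI => ?_
    rw [Finset.mem_piAntidiag] at hI
    rw [Finset.prod_congr rfl fun k _ => ite_steenrodCoeff _ _ _ _ _]
    unfold diagonalCoeff
    rw [Finset.prod_boole]
    congr 1
    refine propext ?_
    have := Cell.forall_isDiagonal_iff I a b s
    rw [show ∑ k, I k = i from hI.1] at this
    rw [← this]
    simp
  rw [h1]
  by_cases h : IsDiagonal Vertex.weight (i + n + 1) a.flat b.flat s.flat
  · have hpos := fun k => Finset.card_pos.2 (Cell.inter_nonempty_of_isDiagonal h k)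
    -- The intersections are nonempty, so the truncated subtraction defining the multi-index loses
    -- nothing.
    have hcard : ∀ k, (a.simplex k ∩ b.simplex k).card =
        (a.simplex k ∩ b.simplex k).card - 1 + 1 := fun k => by have := hpos k; omega
    rw [Finset.sum_eq_single fun k => (a.simplex k ∩ b.simplex k).card - 1, if_pos ⟨hcard, h⟩,
      diagonalCoeff, if_pos h]
    · intro I _ hI
      rw [if_neg]
      rintro ⟨h', -⟩
      exact hI (funext fun k => by rw [h' k, Nat.add_sub_cancel])
    · intro hI
      refine absurd (Finset.mem_piAntidiag.2 ⟨?_, fun _ _ => Finset.mem_univ _⟩) hI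
      have := h.2.1
      unfold Cell.flat at this
      rw [flatten_inter, card_flatten, Finset.sum_congr rfl fun k _ => hcard k,
        Finset.sum_add_distrib] at this
      simp only [Finset.sum_const, Finset.card_univ, Fintype.card_fin, smul_eq_mul, mul_one] at this
      omega
  · rw [diagonalCoeff, if_neg h, Finset.sum_eq_zero]
    intro I _
    rw [if_neg fun h' => h h'.2]

/-! ## Properties of the diagonals of tuples -/

lemma subset_of_diagonalCoeff_ne_zero {V : Type} [LinearOrder V] {κ : V → ℕ} {m : ℕ}
    {A B S : Finset V} (h : diagonalCoeff κ m A B S ≠ 0) : A ⊆ S ∧ B ⊆ S := by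
  have h' : A ∪ B = S := by
    by_contra h'
    exact h (diagonalCoeff_eq_zero h')
  rw [← h']
  exact ⟨Finset.subset_union_left, Finset.subset_union_right⟩

lemma isDiagonal_of_cupCoeff_ne_zero {i : ℕ} {a b s : Cell Δ} (h : cupCoeff i a b s ≠ 0) :
    IsDiagonal Vertex.weight (i + n + 1) a.flat b.flat s.flat := by
  rw [cupCoeff_eq] at h
  by_contra h'
  exact h (if_neg h')

lemma union_eq_of_cupCoeff_ne_zero {i : ℕ} {a b s : Cell Δ} (h : cupCoeff i a b s ≠ 0)
    (k : Fin (n + 1)) : a.simplex k ∪ b.simplex k = s.simplex k := by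
  have := (isDiagonal_of_cupCoeff_ne_zero h).1
  unfold Cell.flat at this
  rw [flatten_union] at this
  exact congrFun (flatten_injective this) k

lemma dim_of_cupCoeff_ne_zero {i : ℕ} {a b s : Cell Δ} (h : cupCoeff i a b s ≠ 0) :
    s.dim + i = a.dim + b.dim := by
  obtain ⟨h1, h2, -⟩ := isDiagonal_of_cupCoeff_ne_zero h
  have := Finset.card_union_add_card_inter a.flat b.flat
  rw [h1, h2] at this
  rw [Cell.dim_eq, Cell.dim_eq, Cell.dim_eq]
  omega

/-- The common vertex in each factor provides the `-1` needed; this is what makes perverse degrees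
subadditive. -/
lemma dimAt_le_of_cupCoeff_ne_zero {i : ℕ} {a b s : Cell Δ} (h : cupCoeff i a b s ≠ 0)
    (k : Fin (n + 1)) : s.dimAt k ≤ a.dimAt k + b.dimAt k := by
  have h1 := Finset.card_pos.2
    (Cell.inter_nonempty_of_isDiagonal (isDiagonal_of_cupCoeff_ne_zero h) k)
  have h2 := Finset.card_union_add_card_inter (a.simplex k) (b.simplex k)
  rw [union_eq_of_cupCoeff_ne_zero h] at h2
  unfold Cell.dimAt
  omega

/-- The `i + n + 1` common vertices lie among the `dim + n + 1` vertices of either factor. -/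
lemma le_dim_of_cupCoeff_ne_zero {i : ℕ} {a b s : Cell Δ} (h : cupCoeff i a b s ≠ 0) :
    (i : ℤ) ≤ min a.dim b.dim := by
  obtain ⟨-, h2, -⟩ := isDiagonal_of_cupCoeff_ne_zero h
  have h3 := Finset.card_le_card (Finset.inter_subset_left (s₁ := a.flat) (s₂ := b.flat))
  have h4 := Finset.card_le_card (Finset.inter_subset_right (s₁ := a.flat) (s₂ := b.flat))
  rw [Cell.dim_eq, Cell.dim_eq, le_min_iff]
  omega

lemma cupCoeff_self {i : ℕ} {s : Cell Δ} (h : s.dim = i) : cupCoeff i s s s = 1 := by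
  rw [cupCoeff_eq, diagonalCoeff, if_pos]
  rw [Cell.dim_eq] at h
  unfold IsDiagonal
  rw [Finset.union_self, Finset.inter_self]
  exact ⟨rfl, by omega, fun v hv hv' => absurd hv hv'⟩

lemma eq_of_cupCoeff_ne_zero {i : ℕ} {a b s : Cell Δ} (h : cupCoeff i a b s ≠ 0)
    (h' : a.dim = s.dim ∧ b.dim = s.dim) : a = s ∧ b = s := by
  rw [cupCoeff_eq] at h
  have hsub := subset_of_diagonalCoeff_ne_zero h
  rw [Cell.dim_eq, Cell.dim_eq, Cell.dim_eq] at h'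
  exact ⟨Cell.flat_injective (Finset.eq_of_subset_of_card_le hsub.1 (by omega)),
    Cell.flat_injective (Finset.eq_of_subset_of_card_le hsub.2 (by omega))⟩

/-- The weighted diagonal that splits along one vertex less than the factors vanishes. -/
lemma diagonalCoeff_weight_eq_zero (a b : Cell Δ) (S : Finset (Vertex Δ)) :
    diagonalCoeff Vertex.weight n a.flat b.flat S = 0 := by
  refine if_neg fun h => ?_
  have h1 := fun k => Finset.card_pos.2 (Cell.inter_nonempty_of_isDiagonal h k)
  have h2 := h.2.1
  unfold Cell.flat at h2
  rw [flatten_inter, card_flatten] at h2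
  have := Finset.sum_le_sum fun k (_ : k ∈ Finset.univ) => Nat.succ_le_of_lt (h1 k)
  simp at this
  omega

open Classical in
/-- The boundary formula for the diagonals of tuples. -/
lemma sum_diagonalCoeff_flat (m : ℕ) (a b s : Cell Δ) :
    ∑ t : Cell Δ with t.IsFacet s, diagonalCoeff Vertex.weight (m + 1) a.flat b.flat t.flat =
      diagonalCoeff Vertex.weight m a.flat b.flat s.flat +
      diagonalCoeff Vertex.weight m b.flat a.flat s.flat +
      (∑ t : Cell Δ with a.IsFacet t,
        diagonalCoeff Vertex.weight (m + 1) t.flat b.flat s.flat) +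
      ∑ t : Cell Δ with b.IsFacet t,
        diagonalCoeff Vertex.weight (m + 1) a.flat t.flat s.flat := by
  rw [Cell.sum_isFacet a s _ fun T h => (subset_of_diagonalCoeff_ne_zero h).1,
    Cell.sum_isFacet_of a s (fun T => diagonalCoeff Vertex.weight (m + 1) T b.flat s.flat)
      fun T h => (subset_of_diagonalCoeff_ne_zero h).1,
    Cell.sum_isFacet_of b s (fun T => diagonalCoeff Vertex.weight (m + 1) a.flat T s.flat)
      fun T h => (subset_of_diagonalCoeff_ne_zero h).2,
    sum_diagonalCoeff_erase]

open Classical in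
lemma sum_cupCoeff_succ (i : ℕ) (a b s : Cell Δ) :
    ∑ t : Cell Δ with t.IsFacet s, cupCoeff (i + 1) a b t =
      cupCoeff i a b s + cupCoeff i b a s +
      (∑ t : Cell Δ with a.IsFacet t, cupCoeff (i + 1) t b s) +
      ∑ t : Cell Δ with b.IsFacet t, cupCoeff (i + 1) a t s := by
  simp only [cupCoeff_eq]
  rw [show i + 1 + n + 1 = (i + n + 1) + 1 by omega]
  exact sum_diagonalCoeff_flat _ a b s

-- This is the boundary formula with `m = n`, whose two end terms vanish; it reflects `d e₀ = 0`.
open Classical in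
lemma sum_cupCoeff_zero (a b s : Cell Δ) :
    ∑ t : Cell Δ with t.IsFacet s, cupCoeff 0 a b t =
      (∑ t : Cell Δ with a.IsFacet t, cupCoeff 0 t b s) +
      ∑ t : Cell Δ with b.IsFacet t, cupCoeff 0 a t s := by
  have h := sum_diagonalCoeff_flat n a b s
  rw [diagonalCoeff_weight_eq_zero, diagonalCoeff_weight_eq_zero, add_zero, zero_add] at h
  simpa only [cupCoeff_eq, zero_add] using h

/-! ### Compatibility of the diagonals with face maps -/

lemma steenrodCoeff_map {V W : Type} [LinearOrder V] [LinearOrder W] (f : V ↪o W) (i : ℕ)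
    (a b s : Finset V) :
    steenrodCoeff i (a.map f.toEmbedding) (b.map f.toEmbedding) (s.map f.toEmbedding) =
      steenrodCoeff i a b s := by
  have h : ∀ v, (((a ∩ b).map f.toEmbedding).filter (· < f v)).card =
      ((a ∩ b).filter (· < v)).card := by
    intro v
    rw [Finset.filter_map, Finset.card_map]
    congr 1
    refine Finset.filter_congr fun w _ => ?_
    exact f.lt_iff_lt
  unfold steenrodCoeff
  congr 1
  rw [← Finset.map_union, ← Finset.map_inter, Finset.map_inj, Finset.card_map]
  refine propext (and_congr_right fun _ => and_congr_right fun _ => ?_)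
  simp [h]

lemma cupCoeff_map (f : Δ ⟶ Δ') (i : ℕ) (a b s : Cell Δ) :
    cupCoeff i (a.map f) (b.map f) (s.map f) = cupCoeff i a b s := by
  unfold cupCoeff Cell.map
  simp only [steenrodCoeff_map]

lemma Cell.exists_map_eq (f : Δ ⟶ Δ') {s : Cell Δ} {t : Cell Δ'}
    (h : ∀ k, t.simplex k ⊆ (s.map f).simplex k) : ∃ t' : Cell Δ, t'.map f = t := by
  choose w hw hw' using fun i => Finset.subset_map_iff.1 (h i)
  refine ⟨⟨w, fun i => ?_, fun h' => s.top_notMem (hw _ h')⟩, Cell.ext (funext fun i => (hw' i).symm)⟩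
  have := t.nonempty i
  rw [hw' i] at this
  exact Finset.map_nonempty.1 this

/-! ## Properties of the cup-`i` products on the blow-up of a simplex -/

namespace LocalCochain

/-- Only faces of the image of `s` occur in its diagonal, and these are themselves images of tuples
of `Δ`. -/
lemma cup_comp_map (f : Δ ⟶ Δ') (i : ℕ) (c c' : LocalCochain Δ') :
    cup i (c ∘ Cell.map f) (c' ∘ Cell.map f) = cup i c c' ∘ Cell.map f := by
  funext s
  unfold cup
  have hsub : ∀ {a b : Cell Δ'}, cupCoeff i a b (s.map f) ≠ 0 →
      (∃ a', Cell.map f a' = a) ∧ ∃ b', Cell.map f b' = b := fun h =>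
    ⟨Cell.exists_map_eq f fun k => by
        rw [← union_eq_of_cupCoeff_ne_zero h k]
        exact Finset.subset_union_left,
      Cell.exists_map_eq f fun k => by
        rw [← union_eq_of_cupCoeff_ne_zero h k]
        exact Finset.subset_union_right⟩
  refine Finset.sum_of_injOn (Cell.map f) (Cell.map_injective f).injOn (fun _ _ => by simp) ?_ ?_
  · intro a _ ha
    refine Finset.sum_eq_zero fun b _ => ?_
    by_contra h
    obtain ⟨⟨a', ha'⟩, -⟩ := hsub (left_ne_zero_of_mul h)
    exact ha ⟨a', by simp, ha'⟩
  · intro a _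
    refine Finset.sum_of_injOn (Cell.map f) (Cell.map_injective f).injOn (fun _ _ => by simp) ?_ ?_
    · intro b _ hb
      by_contra h
      obtain ⟨-, b', hb'⟩ := hsub (left_ne_zero_of_mul h)
      exact hb ⟨b', by simp, hb'⟩
    · intro b _
      rw [cupCoeff_map]
      rfl

/-- The cup-`i` product as a bilinear map. -/
def cupBilin (i : ℕ) : LocalCochain Δ →ₗ[ZMod 2] LocalCochain Δ →ₗ[ZMod 2] LocalCochain Δ :=
  LinearMap.mk₂ (ZMod 2) (cup i)
    (fun c₁ c₂ c' => by
      funext s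
      simp only [cup, Pi.add_apply, ← Finset.sum_add_distrib]
      exact Finset.sum_congr rfl fun a _ => Finset.sum_congr rfl fun b _ => by ring)
    (fun r c c' => by
      funext s
      simp only [cup, Pi.smul_apply, smul_eq_mul, Finset.mul_sum]
      exact Finset.sum_congr rfl fun a _ => Finset.sum_congr rfl fun b _ => by ring)
    (fun c c₁ c₂ => by
      funext s
      simp only [cup, Pi.add_apply, ← Finset.sum_add_distrib]
      exact Finset.sum_congr rfl fun a _ => Finset.sum_congr rfl fun b _ => by ring)
    (fun r c c' => by
      funext s
      simp only [cup, Pi.smul_apply, smul_eq_mul, Finset.mul_sum]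
      exact Finset.sum_congr rfl fun a _ => Finset.sum_congr rfl fun b _ => by ring)

lemma exists_of_cup_ne_zero {i : ℕ} {c c' : LocalCochain Δ} {s : Cell Δ} (h : cup i c c' s ≠ 0) :
    ∃ a b, cupCoeff i a b s ≠ 0 ∧ c a ≠ 0 ∧ c' b ≠ 0 := by
  obtain ⟨a, -, ha⟩ := Finset.exists_ne_zero_of_sum_ne_zero h
  obtain ⟨b, -, hb⟩ := Finset.exists_ne_zero_of_sum_ne_zero ha
  exact ⟨a, b, left_ne_zero_of_mul hb, left_ne_zero_of_mul (right_ne_zero_of_mul hb),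
    right_ne_zero_of_mul (right_ne_zero_of_mul hb)⟩

open Classical in
lemma coboundary_apply (c : LocalCochain Δ) (s : Cell Δ) :
    coboundary c s = ∑ t with t.IsFacet s, c t :=
  rfl

-- This formula and the next two collect the coefficient of `c a * c' b`, moving the coboundary onto
-- the diagonal; the Leibniz rules then become `sum_cupCoeff_succ` and `sum_cupCoeff_zero`.
open Classical in
lemma coboundary_cup_apply (i : ℕ) (c c' : LocalCochain Δ) (s : Cell Δ) :
    coboundary (cup i c c') s =
      ∑ a, ∑ b, (∑ t : Cell Δ with t.IsFacet s, cupCoeff i a b t) * (c a * c' b) := by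
  rw [coboundary_apply]
  unfold cup
  rw [Finset.sum_comm]
  refine Finset.sum_congr rfl fun a _ => ?_
  rw [Finset.sum_comm]
  simp only [Finset.sum_mul]

open Classical in
lemma cup_coboundary_left_apply (i : ℕ) (c c' : LocalCochain Δ) (s : Cell Δ) :
    cup i (coboundary c) c' s =
      ∑ a, ∑ b, (∑ t : Cell Δ with a.IsFacet t, cupCoeff i t b s) * (c a * c' b) := by
  simp only [cup, coboundary_apply, Finset.sum_filter, Finset.sum_mul, Finset.mul_sum]
  rw [Finset.sum_congr rfl fun t _ => Finset.sum_comm, Finset.sum_comm]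
  refine Finset.sum_congr rfl fun a _ => ?_
  rw [Finset.sum_comm]
  refine Finset.sum_congr rfl fun b _ => Finset.sum_congr rfl fun t _ => ?_
  split_ifs <;> ring

open Classical in
lemma cup_coboundary_right_apply (i : ℕ) (c c' : LocalCochain Δ) (s : Cell Δ) :
    cup i c (coboundary c') s =
      ∑ a, ∑ b, (∑ t : Cell Δ with b.IsFacet t, cupCoeff i a t s) * (c a * c' b) := by
  simp only [cup, coboundary_apply, Finset.sum_filter, Finset.sum_mul, Finset.mul_sum]
  refine Finset.sum_congr rfl fun a _ => ?_
  rw [Finset.sum_comm]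
  refine Finset.sum_congr rfl fun b _ => Finset.sum_congr rfl fun t _ => ?_
  split_ifs <;> ring

lemma coboundary_cup_succ (i : ℕ) (c c' : LocalCochain Δ) :
    coboundary (cup (i + 1) c c') = cup i c c' + cup i c' c + cup (i + 1) (coboundary c) c' +
      cup (i + 1) c (coboundary c') := by
  classical
  funext s
  have h : cup i c' c s = ∑ a, ∑ b, cupCoeff i b a s * (c a * c' b) := by
    unfold cup
    rw [Finset.sum_comm]
    simp only [mul_comm (c' _)]
  rw [Pi.add_apply, Pi.add_apply, Pi.add_apply, coboundary_cup_apply, cup_coboundary_left_apply,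
    cup_coboundary_right_apply, h]
  unfold cup
  simp only [← Finset.sum_add_distrib, ← add_mul, sum_cupCoeff_succ]

lemma coboundary_cup_zero (c c' : LocalCochain Δ) :
    coboundary (cup 0 c c') = cup 0 (coboundary c) c' + cup 0 c (coboundary c') := by
  classical
  funext s
  rw [Pi.add_apply, coboundary_cup_apply, cup_coboundary_left_apply, cup_coboundary_right_apply]
  simp only [← Finset.sum_add_distrib, ← add_mul, sum_cupCoeff_zero]

/-- A contributing pair has `a`, `b` and `s` all of dimension `i`, hence `a = b = s`, and squaring
is the identity on `𝔽₂`. -/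
lemma cup_self {i : ℕ} {c : LocalCochain Δ} (h : ∀ s, c s ≠ 0 → s.dim = i) : cup i c c = c := by
  funext s
  have hzmod : ∀ x : ZMod 2, 1 * (x * x) = x := by decide
  have hterm : ∀ a b, cupCoeff i a b s * (c a * c b) ≠ 0 → a = s ∧ b = s := by
    intro a b hab
    have h1 := left_ne_zero_of_mul hab
    have h2 := h _ (left_ne_zero_of_mul (right_ne_zero_of_mul hab))
    have h3 := h _ (right_ne_zero_of_mul (right_ne_zero_of_mul hab))
    have h4 := dim_of_cupCoeff_ne_zero h1
    exact eq_of_cupCoeff_ne_zero h1 ⟨by omega, by omega⟩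
  unfold cup
  rw [Finset.sum_eq_single_of_mem s (Finset.mem_univ _),
    Finset.sum_eq_single_of_mem s (Finset.mem_univ _)]
  · by_cases hs : c s = 0
    · rw [hs, mul_zero, mul_zero]
    · rw [cupCoeff_self (h s hs), hzmod]
  · intro b _ hb
    by_contra h'
    exact hb (hterm s b h').2
  · intro a _ ha
    refine Finset.sum_eq_zero fun b _ => ?_
    by_contra h'
    exact ha (hterm a b h').1

end LocalCochain

/-! ## Cup-`i` products of global sections -/

namespace Sections

variable {K K' : FilteredFaceSet.{u} n}

/-- The product `(c ∪_i c')_σ = c_σ ∪_i c'_σ` of global sections. -/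
def cup (i : ℕ) : Sections K →ₗ[ZMod 2] Sections K →ₗ[ZMod 2] Sections K :=
  LinearMap.mk₂ (ZMod 2)
    (fun c c' => ⟨fun Δ σ => LocalCochain.cup i (c.1 Δ σ) (c'.1 Δ σ), fun Δ Δ' f σ => by
      refine (congrArg₂ (LocalCochain.cup i) (c.2 Δ Δ' f σ) (c'.2 Δ Δ' f σ)).trans ?_
      exact LocalCochain.cup_comp_map f.hom i _ _⟩)
    (fun c₁ c₂ c' => Subtype.ext (funext fun Δ => funext fun σ =>
      LinearMap.map_add₂ (LocalCochain.cupBilin i) (c₁.1 Δ σ) (c₂.1 Δ σ) (c'.1 Δ σ)))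
    (fun r c c' => Subtype.ext (funext fun Δ => funext fun σ =>
      LinearMap.map_smul₂ (LocalCochain.cupBilin i) r (c.1 Δ σ) (c'.1 Δ σ)))
    (fun c c₁ c₂ => Subtype.ext (funext fun Δ => funext fun σ =>
      map_add (LocalCochain.cupBilin i (c.1 Δ σ)) (c₁.1 Δ σ) (c₂.1 Δ σ)))
    (fun r c c' => Subtype.ext (funext fun Δ => funext fun σ =>
      map_smul (LocalCochain.cupBilin i (c.1 Δ σ)) r (c'.1 Δ σ)))

lemma coboundary_cup_succ (i : ℕ) (c c' : Sections K) :
    coboundary (cup (i + 1) c c') = cup i c c' + cup i c' c + cup (i + 1) (coboundary c) c' +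
      cup (i + 1) c (coboundary c') :=
  Subtype.ext (funext fun Δ => funext fun σ =>
    LocalCochain.coboundary_cup_succ i (c.1 Δ σ) (c'.1 Δ σ))

lemma coboundary_cup_zero (c c' : Sections K) :
    coboundary (cup 0 c c') = cup 0 (coboundary c) c' + cup 0 c (coboundary c') :=
  Subtype.ext (funext fun Δ => funext fun σ =>
    LocalCochain.coboundary_cup_zero (c.1 Δ σ) (c'.1 Δ σ))

lemma cup_self {i : ℕ} {c : Sections K} (hc : c ∈ degree K i) : cup i c c = c :=
  Subtype.ext (funext fun Δ => funext fun σ => LocalCochain.cup_self fun s => hc Δ σ s)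

lemma cup_eq_zero {i : ℕ} {r s : ℤ} (h : min r s < i) {c c' : Sections K} (hc : c ∈ degree K r)
    (hc' : c' ∈ degree K s) : cup i c c' = 0 := by
  refine Subtype.ext (funext fun Δ => funext fun σ => funext fun u => ?_)
  by_contra hu
  obtain ⟨a, b, hab, ha, hb⟩ := LocalCochain.exists_of_cup_ne_zero hu
  have := le_dim_of_cupCoeff_ne_zero hab
  rw [hc Δ σ a ha, hc' Δ σ b hb] at this
  omega

lemma cup_mem_degree {i : ℕ} {r s k : ℤ} (h : k + i = r + s) {c c' : Sections K}
    (hc : c ∈ degree K r) (hc' : c' ∈ degree K s) : cup i c c' ∈ degree K k := by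
  intro Δ σ u hu
  obtain ⟨a, b, hab, ha, hb⟩ := LocalCochain.exists_of_cup_ne_zero hu
  have := dim_of_cupCoeff_ne_zero hab
  rw [hc Δ σ a ha, hc' Δ σ b hb] at this
  omega

/-- If the apex is missing from a factor of `s = a ∪ b`, it is missing there from `a` and `b`, so
both perversity bounds apply and can be added factor by factor. -/
lemma Admissible.cup {p q : LoosePerversity} {c c' : Sections K} (hc : Admissible p c)
    (hc' : Admissible q c') (i : ℕ) : Admissible (p + q) (cup i c c') := by
  rw [admissible_iff] at *
  intro ℓ h1 h2 Δ σ s hs hs'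
  obtain ⟨a, b, hab, ha, hb⟩ := LocalCochain.exists_of_cup_ne_zero hs
  have hU := union_eq_of_cupCoeff_ne_zero hab
  have ha' := hc ℓ h1 h2 Δ σ a ha fun k hk h => hs' k hk (by
    rw [← hU]
    exact Finset.mem_union_left _ h)
  have hb' := hc' ℓ h1 h2 Δ σ b hb fun k hk h => hs' k hk (by
    rw [← hU]
    exact Finset.mem_union_right _ h)
  refine (Finset.sum_le_sum fun k _ => dimAt_le_of_cupCoeff_ne_zero hab k).trans ?_
  rw [Finset.sum_add_distrib]
  exact _root_.add_le_add ha' hb'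

lemma cup_mem_intersection {p q : LoosePerversity} {i : ℕ} {r s k : ℤ} (h : k + i = r + s)
    {c c' : Sections K} (hc : c ∈ intersection K p r) (hc' : c' ∈ intersection K q s) :
    cup i c c' ∈ intersection K (p + q) k := by
  obtain ⟨h1, h2, h3⟩ := hc
  obtain ⟨h1', h2', h3'⟩ := hc'
  refine ⟨cup_mem_degree h h1 h1', h2.cup h2' i, ?_⟩
  cases i with
  | zero =>
    rw [coboundary_cup_zero]
    exact (h3.cup h2' 0).add (h2.cup h3' 0)
  | succ i =>
    rw [coboundary_cup_succ]
    refine (((h2.cup h2' i).add ?_).add (h3.cup h2' _)).add (h2.cup h3' _)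
    -- The swapped product produced by the Leibniz rule is admissible for `q + p`.
    rw [LoosePerversity.add_comm]
    exact h2'.cup h2 i

/-- The restriction of the cup-`i` product to sections of intersection. -/
def intersectionCup (p q : LoosePerversity) (i : ℕ) (r s k : ℤ) (h : k + i = r + s) :
    intersection K p r →ₗ[ZMod 2] intersection K q s →ₗ[ZMod 2] intersection K (p + q) k :=
  LinearMap.mk₂ (ZMod 2) (fun x y => ⟨cup i x.1 y.1, cup_mem_intersection h x.2 y.2⟩)
    (fun x₁ x₂ y => Subtype.ext (LinearMap.map_add₂ (cup i) x₁.1 x₂.1 y.1))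
    (fun a x y => Subtype.ext (LinearMap.map_smul₂ (cup i) a x.1 y.1))
    (fun x y₁ y₂ => Subtype.ext (map_add (cup i x.1) y₁.1 y₂.1))
    (fun a x y => Subtype.ext (map_smul (cup i x.1) a y.1))

/-- The restriction of the opposite of the cup-`i` product to sections of intersection. -/
def intersectionCupOp (p q : LoosePerversity) (i : ℕ) (r s k : ℤ) (h : k + i = r + s) :
    intersection K p r →ₗ[ZMod 2] intersection K q s →ₗ[ZMod 2] intersection K (p + q) k :=
  LinearMap.mk₂ (ZMod 2)
    (fun x y => ⟨cup i y.1 x.1, by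
      rw [LoosePerversity.add_comm]
      exact cup_mem_intersection (h.trans (_root_.add_comm r s)) y.2 x.2⟩)
    (fun x₁ x₂ y => Subtype.ext (map_add (cup i y.1) x₁.1 x₂.1))
    (fun a x y => Subtype.ext (map_smul (cup i y.1) a x.1))
    (fun x y₁ y₂ => Subtype.ext (LinearMap.map_add₂ (cup i) y₁.1 y₂.1 x.1))
    (fun a x y => Subtype.ext (LinearMap.map_smul₂ (cup i) a y.1 x.1))

/-- The action of `𝓔(2)` on the sections of intersection. -/
def intersectionAction (p q : LoosePerversity) (i : ℕ) (r s k : ℤ) (h : k + i = r + s) :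
    E2 →ₗ[ZMod 2] intersection K p r →ₗ[ZMod 2] intersection K q s →ₗ[ZMod 2]
      intersection K (p + q) k :=
  (LinearMap.proj false : E2 →ₗ[ZMod 2] ZMod 2).smulRight (intersectionCup (K := K) p q i r s k h) +
    (LinearMap.proj true : E2 →ₗ[ZMod 2] ZMod 2).smulRight (intersectionCupOp (K := K) p q i r s k h)

lemma intersectionAction_val (p q : LoosePerversity) (i : ℕ) (r s k : ℤ) (h : k + i = r + s)
    (g : E2) (x : intersection K p r) (y : intersection K q s) :
    (intersectionAction p q i r s k h g x y).1 =
      g false • cup i x.1 y.1 + g true • cup i y.1 x.1 :=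
  rfl

/-- The coboundaries enter as `dx` and `dy` with equations on the underlying sections, so that the
differentials of `intersectionComplex` can be substituted later. -/
lemma coboundary_intersectionAction_zero (p q : LoosePerversity) (r s k : ℤ)
    (h : k + (0 : ℕ) = r + s) (h' : k + 1 + (0 : ℕ) = r + 1 + s) (h'' : k + 1 + (0 : ℕ) = r + (s + 1))
    (g : E2) (x : intersection K p r) (y : intersection K q s) (dx : intersection K p (r + 1))
    (dy : intersection K q (s + 1)) (hx : dx.1 = coboundary x.1) (hy : dy.1 = coboundary y.1) :
    coboundary (intersectionAction p q 0 r s k h g x y).1 =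
      (intersectionAction p q 0 (r + 1) s (k + 1) h' g dx y +
        intersectionAction p q 0 r (s + 1) (k + 1) h'' g x dy).1 := by
  rw [Submodule.coe_add]
  simp only [intersectionAction_val, hx, hy]
  rw [map_add, map_smul, map_smul, coboundary_cup_zero, coboundary_cup_zero]
  module

lemma coboundary_intersectionAction_succ (p q : LoosePerversity) (i : ℕ) (r s k : ℤ)
    (h : k + (i + 1 : ℕ) = r + s) (h₀ : k + 1 + i = r + s) (h' : k + 1 + (i + 1 : ℕ) = r + 1 + s)
    (h'' : k + 1 + (i + 1 : ℕ) = r + (s + 1))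
    (g : E2) (x : intersection K p r) (y : intersection K q s) (dx : intersection K p (r + 1))
    (dy : intersection K q (s + 1)) (hx : dx.1 = coboundary x.1) (hy : dy.1 = coboundary y.1) :
    coboundary (intersectionAction p q (i + 1) r s k h g x y).1 =
      (intersectionAction p q i r s (k + 1) h₀ (E2.d g) x y +
        intersectionAction p q (i + 1) (r + 1) s (k + 1) h' g dx y +
        intersectionAction p q (i + 1) r (s + 1) (k + 1) h'' g x dy).1 := by
  have hadd : ∀ a b c : intersection K (p + q) (k + 1), (a + b + c).1 = a.1 + b.1 + c.1 :=
    fun _ _ _ => rfl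
  simp only [hadd, intersectionAction_val, hx, hy, E2.d]
  -- The products by `e` and by `τ` yield the same symmetric lower term, which therefore has
  -- coefficient `g false + g true`, as in `E2.d g`.
  rw [map_add, map_smul, map_smul, coboundary_cup_succ, coboundary_cup_succ]
  module

end Sections

/-! ### The structure on perverse cochain complexes, and its naturality -/

lemma intersectionComplex_d_val (K : FilteredFaceSet.{u} n) (p : LoosePerversity) (k : ℤ)
    (x : Sections.intersection K p k) :
    (show Sections.intersection K p (k + 1) from (intersectionComplex K p).d k (k + 1) x).1 =
      Sections.coboundary x.1 := by
  have h : (intersectionComplex K p).d k (k + 1) = ModuleCat.ofHom (Sections.coboundary.restrict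
      fun _ hc => Sections.coboundary_mem_intersection rfl hc) := dif_pos rfl
  rw [h]
  rfl

/-- The perverse `𝓔(2)`-algebra structure on the blow-up cochains of a filtered face set. -/
def blowupStructure (K : FilteredFaceSet.{u} n) : PerverseE2Structure (blowup K) where
  ψ := Sections.intersectionAction
  cochain_zero p q r s k _ g x y :=
    Subtype.ext ((intersectionComplex_d_val K _ k _).trans
      (Sections.coboundary_intersectionAction_zero p q r s k _ _ _ g x y _ _
        (intersectionComplex_d_val K p r x) (intersectionComplex_d_val K q s y)))
  cochain_succ p q i r s k _ g x y :=
    Subtype.ext ((intersectionComplex_d_val K _ k _).trans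
      (Sections.coboundary_intersectionAction_succ p q i r s k _ _ _ _ g x y _ _
        (intersectionComplex_d_val K p r x) (intersectionComplex_d_val K q s y)))
  -- Changes of perversity do not alter the underlying section, so only the order of the `e` and `τ`
  -- summands differs.
  equivariant _ _ _ _ _ _ _ _ _ _ := Subtype.ext (add_comm _ _)
  natural _ _ _ _ _ _ _ _ _ _ _ _ _ _ := rfl

lemma blowupStructure_cup_val (K : FilteredFaceSet.{u} n) (p q : LoosePerversity) (i : ℕ)
    (r s k : ℤ) (h : k + i = r + s) (x : Sections.intersection K p r)
    (y : Sections.intersection K q s) :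
    (show Sections.intersection K (p + q) k from (blowupStructure K).cup i k h x y).1 =
      Sections.cup i x.1 y.1 := by
  refine (Sections.intersectionAction_val p q i r s k h E2.e x y).trans ?_
  rw [show E2.e false = 1 from rfl, show E2.e true = 0 from rfl, one_smul, zero_smul, add_zero]

lemma isNice_blowupStructure (K : FilteredFaceSet.{u} n) : (blowupStructure K).IsNice where
  cup_self p _ _ _ r x := Subtype.ext
    ((blowupStructure_cup_val K p p r r r r rfl x x).trans (Sections.cup_self x.2.1))
  cup_eq_zero p q i r s k h x y hi := Subtype.ext
    ((blowupStructure_cup_val K p q i r s k h x y).trans (Sections.cup_eq_zero hi x.2.1 y.2.1))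

/-- Pulling back only reindexes the simplices, and the product is computed simplex by simplex. -/
lemma isMorphism_blowupMap {K K' : FilteredFaceSet.{u} n} (f : K ⟶ K') :
    (blowupStructure K').IsMorphism (blowupStructure K) (blowupMap f) :=
  fun _ _ _ _ _ _ _ _ _ _ => rfl

end PerverseCochain

end

theorem mainTheorem7 (n : ℕ) :
    ∃ S : ∀ X : Pseudomanifold.{u} n,
        PerverseE2Structure ((intersectionCochains n).obj (op X)),
      -- the structures are nice,
      (∀ X, (S X).IsNice) ∧
      -- natural with respect to stratum preserving maps,
      (∀ (X Y : Pseudomanifold.{u} n) (f : X ⟶ Y),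
        (S Y).IsMorphism (S X) ((intersectionCochains n).map f.op)) ∧
      -- and given by the products on the cochains of the blow-up of each simplex
      (∀ (X : Pseudomanifold.{u} n) (p q : LoosePerversity) (i : ℕ) (r s k : ℤ)
        (h : k + i = r + s) (x : (((intersectionCochains n).obj (op X)).obj p).X r)
        (y : (((intersectionCochains n).obj (op X)).obj q).X s)
        (Δ : RegularSimplex n) (σ : SingularSimplex X Δ.obj),
        component ((S X).cup i k h x y) Δ σ =
          LocalCochain.cup i (component x Δ σ) (component y Δ σ)) := by
  refine ⟨fun X => blowupStructure ((singular n).obj X), fun X => isNice_blowupStructure _,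
    fun X Y f => isMorphism_blowupMap _, fun X p q i r s k h x y Δ σ => ?_⟩
  have hcup := blowupStructure_cup_val ((singular n).obj X) p q i r s k h x y
  exact congrArg (fun c => c.1 Δ σ) hcup
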